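/- Let $\Omega=(0,1)$, $k\ge 1$, $f\in L^2(\Omega)$ (complex valued), and let $\|\cdot\|$ be the $L^2(\Omega)$-norm, $(v,w)=\int_0^1 v\bar w$. Let $u\in H^2(\Omega)$ be the solution of $$u''+k^2u=-f \ \text{ in } (0,1),\qquad u(0)=0,\qquad u'(1)-\mathrm{i}k\,u(1)=0 .$$ For an integer $n\ge 1$ let $h=1/n$, $x_j=j/n$, and let $V_h$ be the space of all $v_h\in H^1(\Omega)$ with $v_h(0)=0$ that are linear polynomials on each $(x_{j-1},x_j)$, $1\le j\le n$. Write $[v]_j=v(x_j-)-v(x_j+)$. For $\gamma\in\mathbb C$ put $$J(u,v)=\sum_{j=1}^{n-1}\gamma h\,[u']_j[\bar v']_j+\gamma h\,\bigl(u'(1)-\mathrm{i}k u(1)\bigr)\bigl(\bar v'(1)-\mathrm{i}k\bar v(1)\bigr),$$ $$a_h(u,v)=(u',v')-k^2(u,v)-\mathrm{i}k\,u(1)\bar v(1)+J(u,v).$$ The CIP-FEM solution is $u_h\in V_h$ with $a_h(u_h,v_h)=(f,v_h)$ for all $v_h\in V_h$. **Theorem (a priori error estimates).** For every $M$ there is $c>0$,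 depending only on $M$, such that for every $C_0$ there is $C>0$, depending only on $M$ and $C_0$, with the following property. Let $\gamma\in\mathbb C$ with $\operatorname{Im}\gamma<0$ and $|\gamma|\le M|\operatorname{Im}\gamma|$ (for purely imaginary $\gamma$ one can take $M=1$), let $k\ge1$, and let $h=1/n$ be so small that $kh\le C_0$ and $|\gamma|\,kh\le c$. Then for every $f\in L^2(\Omega)$ the CIP-FEM solution $u_h$ exists and is unique, and $$\|k(u-u_h)\|\le C\,(|\gamma|+|\gamma|^{-1})\,\min(1,k^3h^2)\,\|f\|,$$ $$\|(u-u_h)'\|\le C\,(|\gamma|+|\gamma|^{-1})\,\bigl(kh+\min(1,k^3h^2)\bigr)\,\|f\| .$$ -/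

import Mathlib

open MeasureTheory

open scoped ComplexConjugate

noncomputable section

/-- `v` is (on `[a, b]`) the continuous representative of an `H¹(a, b)` function with weak
derivative `g ∈ L²(a, b)`: `v(x) = v(a) + ∫_a^x g` for all `x ∈ [a, b]`. -/
def IsL2Primitive (a b : ℝ) (v g : ℝ → ℂ) : Prop :=
  MemLp g 2 (volume.restrict (Set.Ioo a b)) ∧
    ∀ x ∈ Set.Icc a b, v x = v a + ∫ t in a..x, g t

/-- `v ∈ H¹(0, 1)` (as its continuous representative on `[0, 1]`). -/
def MemH1 (v : ℝ → ℂ) : Prop :=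
  ∃ g : ℝ → ℂ, IsL2Primitive 0 1 v g

/-- `u ∈ H²(0, 1)` solves `u'' + k² u = -f` on `(0, 1)`, `u(0) = 0`, `u'(1) - i k u(1) = 0`.
Here `du` and `d2u` are `u'` (its continuous representative) and `u''`. -/
def IsHelmholtzSolution (k : ℝ) (f u : ℝ → ℂ) : Prop :=
  ∃ du d2u : ℝ → ℂ, IsL2Primitive 0 1 u du ∧ IsL2Primitive 0 1 du d2u ∧
    (∀ᵐ x ∂(volume.restrict (Set.Ioo (0 : ℝ) 1)), d2u x + (k : ℂ) ^ 2 * u x = - f x) ∧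
    u 0 = 0 ∧ du 1 - Complex.I * k * u 1 = 0

/-- The `L²(0, 1)` inner product `(v, w) = ∫₀¹ v w̄`. -/
def l2Inner (v w : ℝ → ℂ) : ℂ := ∫ x in (0 : ℝ)..1, v x * conj (w x)

/-- The `L²(0, 1)` norm. -/
def l2Norm (v : ℝ → ℂ) : ℝ := Real.sqrt (∫ x in (0 : ℝ)..1, ‖v x‖ ^ 2)

/-- The mesh node `x_j = j / n`. -/
def node (n j : ℕ) : ℝ := (j : ℝ) / n

/-- The linear finite element space `V_h` on the uniform mesh with `n` cells
(`h = 1 / n`). Only the values on `[0, 1]` matter. -/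
def FESpace (n : ℕ) : Set (ℝ → ℂ) :=
  {v | MemH1 v ∧ v 0 = 0 ∧
    ∀ j < n, ∃ a b : ℂ, ∀ x ∈ Set.Ioo (node n j) (node n (j + 1)), v x = a + b * x}

/-- The jump `[v]_j = v(x_j -) - v(x_j +)`. -/
def jump (n : ℕ) (v : ℝ → ℂ) (j : ℕ) : ℂ :=
  Function.leftLim v (node n j) - Function.rightLim v (node n j)

/-- The penalty form
`J(u,v) = ∑_{j=1}^{n-1} γ h [u']_j [v̄']_j + γ h (u'(1) - i k u(1)) (v̄'(1) - i k v̄(1))`,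
with `h = 1 / n`; `u'(1)` is the limit of `u'` at `1` from inside the interval. -/
def penaltyForm (k : ℝ) (γ : ℂ) (n : ℕ) (u v : ℝ → ℂ) : ℂ :=
  (∑ j ∈ Finset.Ico 1 n, γ * (1 / (n : ℂ)) * jump n (deriv u) j * conj (jump n (deriv v) j)) +
    γ * (1 / (n : ℂ)) * (Function.leftLim (deriv u) 1 - Complex.I * k * u 1) *
      (conj (Function.leftLim (deriv v) 1) - Complex.I * k * conj (v 1))

/-- The form `a_h(u,v) = (u',v') - k² (u,v) - i k u(1) v̄(1) + J(u,v)`. -/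
def cipForm (k : ℝ) (γ : ℂ) (n : ℕ) (u v : ℝ → ℂ) : ℂ :=
  l2Inner (deriv u) (deriv v) - (k : ℂ) ^ 2 * l2Inner u v -
    Complex.I * k * u 1 * conj (v 1) + penaltyForm k γ n u v

/-- `uh ∈ V_h` solves `a_h(uh, v) = (f, v)` for all `v ∈ V_h`. -/
def IsCIPSolution (k : ℝ) (γ : ℂ) (n : ℕ) (f uh : ℝ → ℂ) : Prop :=
  uh ∈ FESpace n ∧ ∀ v ∈ FESpace n, cipForm k γ n uh v = l2Inner f v

end

/-! Write I u for the piecewise linear interpolant of u and Θ for I u - u_h, so that u - u_h is the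
sum of an interpolation error and Θ. In one dimension the derivative of u - I u is orthogonal to the
derivatives of V_h. Hence Θ solves the discrete problem with only two sources, k²(u - I u, ·) and γ
J(I u, ·) (`cipBilin_error`). Both are small: transporting the characteristics u' ∓ iku
(`HelmholtzData.norm_characteristics_le`) bounds u' and ku by the data, hence ‖u''‖ by a multiple of
k‖f‖. The jumps in J(I u, ·) are themselves interpolation errors, because u' is continuous and
satisfies the impedance condition.

The sesquilinear form is replaced by the symmetric bilinear form `cipBilin` on nodal values, with
the conjugation moved into the test function. By symmetry the dual problem is again the Helmholtz
problem.

The imaginary part of the form dissipates the slope jumps and the value at 1 (`dissipation_le`). The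
penalty at 1 is not of one sign, and absorbing its indefinite terms is what requires |γ|kh ≤ c. The
real part gives a Gårding identity: ‖v'‖² and k²‖v‖² agree up to data and dissipation
(`abs_slopeSq_sub_le`).

If k³h² ≤ 1/7, duality (`duality_bound`) bounds ‖Θ‖: a term of size k³h²‖Θ‖² is absorbed, and the
jumps of Θ are controlled by `energy_bound`. If k³h² ≥ 1/7, the minimum in the estimates is at least
1/7 and it is enough to bound u and u_h separately. Stability of u_h (`cip_stability`) comes from
dissipation: summation by parts bounds ‖v'‖² by n times the jump seminorm times ‖v‖
(`slopeSq_sq_le`), so the Gårding identity bounds k‖v‖ in terms of the jumps. The same bound gives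
uniqueness, hence existence by finite dimension. -/

section

open Filter Topology Set

/-! ### Absolutely continuous functions and integration by parts -/

/-- `v` is on `[a, b]` an absolutely continuous function with derivative `g`. -/
def IsPrimitive (a b : ℝ) (v g : ℝ → ℂ) : Prop :=
  IntervalIntegrable g volume a b ∧ ∀ x ∈ Icc a b, v x = v a + ∫ t in a..x, g t

lemma AbsolutelyContinuousOnInterval.of_dist_le {X Y : Type*} [PseudoMetricSpace X]
    [PseudoMetricSpace Y] {f : ℝ → X} {g : ℝ → Y} {a b : ℝ}
    (hg : AbsolutelyContinuousOnInterval g a b)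
    (h : ∀ x ∈ uIcc a b, ∀ y ∈ uIcc a b, dist (f x) (f y) ≤ dist (g x) (g y)) :
    AbsolutelyContinuousOnInterval f a b := by
  rw [absolutelyContinuousOnInterval_iff] at hg ⊢
  intro ε hε
  obtain ⟨δ, hδ, H⟩ := hg ε hε
  refine ⟨δ, hδ, fun E hE hlt => lt_of_le_of_lt ?_ (H E hE hlt)⟩
  refine Finset.sum_le_sum fun i hi => ?_
  have := hE.1 i hi
  exact h _ this.1 _ this.2

namespace IsPrimitive

variable {a b : ℝ} {u v g w : ℝ → ℂ}

lemma intervalIntegrable_subinterval (hg : IntervalIntegrable g volume a b) {x y : ℝ}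
    (hx : x ∈ Icc a b) (hy : y ∈ Icc a b) : IntervalIntegrable g volume x y :=
  hg.mono_set ((uIcc_subset_Icc hx hy).trans Icc_subset_uIcc)

lemma sub_eq (h : IsPrimitive a b v g) {x y : ℝ} (hx : x ∈ Icc a b) (hy : y ∈ Icc a b) :
    v y - v x = ∫ t in x..y, g t := by
  have ha : a ∈ Icc a b := ⟨le_rfl, hx.1.trans hx.2⟩
  rw [h.2 x hx, h.2 y hy, ← intervalIntegral.integral_add_adjacent_intervals
    (intervalIntegrable_subinterval h.1 ha hx) (intervalIntegrable_subinterval h.1 hx hy)]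
  ring

lemma trans (hab : a ≤ b) {c : ℝ} (hbc : b ≤ c) (h : IsPrimitive a b v g)
    (h' : IsPrimitive b c v g) : IsPrimitive a c v g := by
  refine ⟨h.1.trans h'.1, fun x hx => ?_⟩
  rcases le_total x b with hxb | hxb
  · exact h.2 x ⟨hx.1, hxb⟩
  · rw [h'.2 x ⟨hxb, hx.2⟩, h.2 b ⟨hab, le_rfl⟩, add_assoc,
      intervalIntegral.integral_add_adjacent_intervals h.1
        (intervalIntegrable_subinterval h'.1 ⟨le_rfl, hbc⟩ ⟨hxb, hx.2⟩)]

/-- The increments of `v` are dominated by those of the real primitive of `‖g‖`. -/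
lemma absolutelyContinuousOnInterval (hab : a ≤ b) (h : IsPrimitive a b v g) :
    AbsolutelyContinuousOnInterval v a b := by
  have hn := h.1.norm.absolutelyContinuousOnInterval_intervalIntegral (c := a) (by simp)
  refine hn.of_dist_le fun x hx y hy => ?_
  rw [uIcc_of_le hab] at hx hy
  have ha : a ∈ Icc a b := ⟨le_rfl, hab⟩
  rw [dist_comm, dist_comm (∫ t in a..x, _), dist_eq_norm, h.sub_eq hx hy, Real.dist_eq,
    intervalIntegral.integral_interval_sub_left
      (intervalIntegrable_subinterval h.1 ha hy).norm
      (intervalIntegrable_subinterval h.1 ha hx).norm]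
  exact intervalIntegral.norm_integral_le_abs_integral_norm

lemma continuousOn (hab : a ≤ b) (h : IsPrimitive a b v g) : ContinuousOn v (Icc a b) := by
  simpa [uIcc_of_le hab] using (h.absolutelyContinuousOnInterval hab).continuousOn

lemma ae_hasDerivAt (hab : a ≤ b) (h : IsPrimitive a b v g) :
    ∀ᵐ x, x ∈ Icc a b → HasDerivAt v (g x) x := by
  have h₁ : ∀ᵐ x : ℝ, x ≠ a := by simp [ae_iff, measure_singleton]
  have h₂ : ∀ᵐ x : ℝ, x ≠ b := by simp [ae_iff, measure_singleton]
  filter_upwards [h.1.ae_hasDerivAt_integral, h₁, h₂] with x hx hxa hxb hxm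
  have hx' : x ∈ uIcc a b := by rwa [uIcc_of_le hab]
  have := (hx hx' a (by simp)).const_add (v a)
  refine this.congr_of_eventuallyEq ?_
  have : Icc a b ∈ 𝓝 x := Icc_mem_nhds (lt_of_le_of_ne hxm.1 (Ne.symm hxa))
    (lt_of_le_of_ne hxm.2 hxb)
  filter_upwards [this] with y hy using h.2 y hy

/-- The difference between `u * v` and the primitive of the claimed derivative is absolutely
continuous with derivative zero almost everywhere, hence constant. This is the source of every
integration by parts below. -/
lemma mul (hab : a ≤ b) (hu : IsPrimitive a b u w) (hv : IsPrimitive a b v g) :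
    IsPrimitive a b (fun x => u x * v x) (fun x => w x * v x + u x * g x) := by
  have hint : IntervalIntegrable (fun x => w x * v x + u x * g x) volume a b := by
    refine (hu.1.mul_continuousOn ?_).add (hv.1.continuousOn_mul ?_)
    · simpa [uIcc_of_le hab] using hv.continuousOn hab
    · simpa [uIcc_of_le hab] using hu.continuousOn hab
  have hP : IsPrimitive a b (fun x => ∫ t in a..x, (w t * v t + u t * g t))
      (fun x => w x * v x + u x * g x) := ⟨hint, fun x _ => by simp⟩
  have huv : AbsolutelyContinuousOnInterval (fun x => u x * v x) a b := by
    simpa only [smul_eq_mul] using (hu.absolutelyContinuousOnInterval hab).fun_smul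
      (hv.absolutelyContinuousOnInterval hab)
  have hac : AbsolutelyContinuousOnInterval (fun x => u x * v x -
      ∫ t in a..x, (w t * v t + u t * g t)) a b :=
    huv.fun_sub (hP.absolutelyContinuousOnInterval hab)
  obtain ⟨C, hC⟩ := hac.const_of_ae_hasDerivAt_zero (by
    filter_upwards [hu.ae_hasDerivAt hab, hv.ae_hasDerivAt hab, hP.ae_hasDerivAt hab]
      with x h1 h2 h3 hx
    rw [uIcc_of_le hab] at hx
    have := ((h1 hx).mul (h2 hx)).sub (h3 hx)
    rw [sub_self] at this
    exact this)
  rw [uIcc_of_le hab] at hC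
  refine ⟨hint, fun x hx => ?_⟩
  have h1 := hC x hx
  have h2 := hC a ⟨le_rfl, hab⟩
  simp only [intervalIntegral.integral_same, sub_zero] at h2
  dsimp only
  rw [h2, ← h1]; ring

lemma congr_ae (hab : a ≤ b) {g' : ℝ → ℂ} (h : IsPrimitive a b v g)
    (hg : g =ᵐ[volume.restrict (Ioc a b)] g') : IsPrimitive a b v g' := by
  have hg' := (ae_restrict_iff' measurableSet_Ioc).1 hg
  refine ⟨h.1.congr_ae (by rwa [uIoc_of_le hab]), fun x hx => ?_⟩
  rw [h.2 x hx]
  congr 1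
  refine intervalIntegral.integral_congr_ae ?_
  filter_upwards [hg'] with y hy hy'
  rw [uIoc_of_le hx.1] at hy'
  exact hy ⟨hy'.1, hy'.2.trans hx.2⟩

lemma add (hu : IsPrimitive a b u w) (hv : IsPrimitive a b v g) :
    IsPrimitive a b (fun x => u x + v x) (fun x => w x + g x) := by
  refine ⟨hu.1.add hv.1, fun x hx => ?_⟩
  have ha : a ∈ Icc a b := ⟨le_rfl, hx.1.trans hx.2⟩
  dsimp only
  rw [intervalIntegral.integral_add (intervalIntegrable_subinterval hu.1 ha hx)
    (intervalIntegrable_subinterval hv.1 ha hx), hu.2 x hx, hv.2 x hx]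
  ring

lemma const_mul (c : ℂ) (hu : IsPrimitive a b u w) :
    IsPrimitive a b (fun x => c * u x) (fun x => c * w x) := by
  refine ⟨hu.1.const_mul c, fun x hx => ?_⟩
  dsimp only
  rw [intervalIntegral.integral_const_mul, hu.2 x hx]
  ring

lemma of_hasDerivAt (h : ∀ x, HasDerivAt v (g x) x) (hg : Continuous g) : IsPrimitive a b v g := by
  refine ⟨hg.intervalIntegrable _ _, fun x _ => ?_⟩
  rw [intervalIntegral.integral_eq_sub_of_hasDerivAt (fun y _ => h y) (hg.intervalIntegrable _ _)]
  ring

end IsPrimitive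

/-! ### L² functions on an interval and the L² norm -/

/-- `f ∈ L²(a, b)`. -/
abbrev IsL2On (a b : ℝ) (f : ℝ → ℂ) : Prop := MemLp f 2 (volume.restrict (Ioo a b))

namespace IsL2On

variable {a b : ℝ} {f g : ℝ → ℂ}

lemma intervalIntegrable (hab : a ≤ b) (hf : IsL2On a b f) : IntervalIntegrable f volume a b := by
  rw [intervalIntegrable_iff_integrableOn_Ioo_of_le hab]
  exact hf.integrable (by norm_num)

lemma intervalIntegrable_sq (hab : a ≤ b) (hf : IsL2On a b f) :
    IntervalIntegrable (fun x => ‖f x‖ ^ 2) volume a b := by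
  rw [intervalIntegrable_iff_integrableOn_Ioo_of_le hab]
  exact hf.integrable_norm_pow (by norm_num)

lemma mono (hf : IsL2On a b f) {c d : ℝ} (hc : a ≤ c) (hd : d ≤ b) : IsL2On c d f :=
  MemLp.mono_measure (Measure.restrict_mono (Ioo_subset_Ioo hc hd) le_rfl) hf

lemma of_continuousOn (hf : ContinuousOn f (Icc a b)) : IsL2On a b f := by
  obtain ⟨C, hC⟩ := isCompact_Icc.exists_bound_of_continuousOn hf
  refine MemLp.of_bound ?_ C ?_
  · exact (hf.mono Ioo_subset_Icc_self).aestronglyMeasurable measurableSet_Ioo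
  · filter_upwards [ae_restrict_mem measurableSet_Ioo] with x hx
      using hC x (Ioo_subset_Icc_self hx)

lemma conj_comp (hf : IsL2On a b f) : IsL2On a b (fun x => conj (f x)) := by
  refine MemLp.of_le hf (Complex.continuous_conj.comp_aestronglyMeasurable hf.1) ?_
  exact Eventually.of_forall fun x => by simp

lemma integral_mul_norm_sq_le (hab : a ≤ b) (hf : IsL2On a b f) (hg : IsL2On a b g) :
    (∫ x in a..b, ‖f x‖ * ‖g x‖) ^ 2 ≤ (∫ x in a..b, ‖f x‖ ^ 2) * ∫ x in a..b, ‖g x‖ ^ 2 := by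
  have h2 : (2 : ENNReal) = ENNReal.ofReal 2 := by simp
  have := integral_mul_norm_le_Lp_mul_Lq (μ := volume.restrict (Ioo a b)) (f := f) (g := g)
    (p := 2) (q := 2) ⟨by norm_num, by norm_num, by norm_num⟩ (h2 ▸ hf) (h2 ▸ hg)
  simp only [intervalIntegral.integral_of_le hab, integral_Ioc_eq_integral_Ioo]
  simp only [Real.rpow_ofNat, ← Real.sqrt_eq_rpow] at this
  have h0 : 0 ≤ ∫ x in Ioo a b, ‖f x‖ ^ 2 := integral_nonneg fun x => by positivity
  have h1 : 0 ≤ ∫ x in Ioo a b, ‖g x‖ ^ 2 := integral_nonneg fun x => by positivity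
  have h3 : 0 ≤ ∫ x in Ioo a b, ‖f x‖ * ‖g x‖ := integral_nonneg fun x => by positivity
  calc _ ≤ (√(∫ x in Ioo a b, ‖f x‖ ^ 2) * √(∫ x in Ioo a b, ‖g x‖ ^ 2)) ^ 2 := by gcongr
    _ = _ := by rw [mul_pow, Real.sq_sqrt h0, Real.sq_sqrt h1]

lemma integral_norm_sq_le (hab : a ≤ b) (hf : IsL2On a b f) :
    (∫ x in a..b, ‖f x‖) ^ 2 ≤ (b - a) * ∫ x in a..b, ‖f x‖ ^ 2 := by
  have := integral_mul_norm_sq_le hab hf (of_continuousOn (f := fun _ => 1) continuousOn_const)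
  simpa [mul_comm] using this

end IsL2On

lemma l2Norm_nonneg (v : ℝ → ℂ) : 0 ≤ l2Norm v := Real.sqrt_nonneg _

lemma l2Norm_sq (v : ℝ → ℂ) : l2Norm v ^ 2 = ∫ x in (0 : ℝ)..1, ‖v x‖ ^ 2 :=
  Real.sq_sqrt (intervalIntegral.integral_nonneg (by norm_num) fun _ _ => by positivity)

lemma l2Norm_congr {v w : ℝ → ℂ} (h : ∀ᵐ x, x ∈ Ioc (0 : ℝ) 1 → ‖v x‖ = ‖w x‖) :
    l2Norm v = l2Norm w := by
  unfold l2Norm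
  congr 1
  refine intervalIntegral.integral_congr_ae ?_
  filter_upwards [h] with x hx hx'
  rw [uIoc_of_le zero_le_one] at hx'
  rw [hx hx']

lemma l2Norm_le_of_bound {v : ℝ → ℂ} {C : ℝ} (hC : 0 ≤ C)
    (hv : ∀ x ∈ Icc (0 : ℝ) 1, ‖v x‖ ≤ C) (hv2 : IsL2On 0 1 v) : l2Norm v ≤ C := by
  refine abs_le_of_sq_le_sq' ?_ hC |>.2
  rw [l2Norm_sq]
  calc _ ≤ ∫ x in (0 : ℝ)..1, C ^ 2 := by
        refine intervalIntegral.integral_mono_on zero_le_one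
          (hv2.intervalIntegrable_sq zero_le_one) (by simp) fun x hx => ?_
        have := hv x hx
        gcongr
    _ = _ := by simp

lemma l2Norm_const_mul (c : ℂ) (v : ℝ → ℂ) : l2Norm (fun x => c * v x) = ‖c‖ * l2Norm v := by
  simp only [l2Norm, norm_mul, mul_pow, intervalIntegral.integral_const_mul]
  rw [Real.sqrt_mul (by positivity), Real.sqrt_sq (norm_nonneg _)]

lemma l2Norm_conj (v : ℝ → ℂ) : l2Norm (fun x => conj (v x)) = l2Norm v := by
  simp [l2Norm]

lemma norm_integral_mul_le {f g : ℝ → ℂ} (hf : IsL2On 0 1 f) (hg : IsL2On 0 1 g) :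
    ‖∫ x in (0 : ℝ)..1, f x * g x‖ ≤ l2Norm f * l2Norm g := by
  refine (intervalIntegral.norm_integral_le_integral_norm zero_le_one).trans ?_
  simp only [norm_mul]
  refine abs_le_of_sq_le_sq' ?_ (mul_nonneg (l2Norm_nonneg _) (l2Norm_nonneg _)) |>.2
  rw [mul_pow, l2Norm_sq, l2Norm_sq]
  exact IsL2On.integral_mul_norm_sq_le zero_le_one hf hg

lemma integral_norm_le_l2Norm {f : ℝ → ℂ} (hf : IsL2On 0 1 f) :
    ∫ x in (0 : ℝ)..1, ‖f x‖ ≤ l2Norm f := by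
  refine abs_le_of_sq_le_sq' ?_ (l2Norm_nonneg _) |>.2
  rw [l2Norm_sq]
  simpa using IsL2On.integral_norm_sq_le zero_le_one hf

lemma l2Norm_add_le {f g : ℝ → ℂ} (hf : IsL2On 0 1 f) (hg : IsL2On 0 1 g) :
    l2Norm (fun x => f x + g x) ≤ l2Norm f + l2Norm g := by
  have hab : (0 : ℝ) ≤ 1 := zero_le_one
  have hfg : IntervalIntegrable (fun x => ‖f x‖ * ‖g x‖) volume 0 1 := by
    rw [intervalIntegrable_iff_integrableOn_Ioo_of_le hab]
    exact MemLp.integrable_mul (p := 2) (q := 2) hf.norm hg.norm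
  refine abs_le_of_sq_le_sq' ?_ (add_nonneg (l2Norm_nonneg _) (l2Norm_nonneg _)) |>.2
  have hcs : ∫ x in (0 : ℝ)..1, ‖f x‖ * ‖g x‖ ≤ l2Norm f * l2Norm g := by
    refine abs_le_of_sq_le_sq' ?_ (mul_nonneg (l2Norm_nonneg _) (l2Norm_nonneg _)) |>.2
    rw [mul_pow, l2Norm_sq, l2Norm_sq]
    exact IsL2On.integral_mul_norm_sq_le zero_le_one hf hg
  rw [add_sq, l2Norm_sq, l2Norm_sq, l2Norm_sq]
  have hfgm : IsL2On 0 1 (fun x => f x + g x) := MemLp.add hf hg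
  have : ∫ x in (0 : ℝ)..1, ‖f x + g x‖ ^ 2 ≤
      ∫ x in (0 : ℝ)..1, (‖f x‖ ^ 2 + 2 * (‖f x‖ * ‖g x‖) + ‖g x‖ ^ 2) := by
    refine intervalIntegral.integral_mono_on hab (hfgm.intervalIntegrable_sq hab)
      (((hf.intervalIntegrable_sq hab).add (hfg.const_mul 2)).add
        (hg.intervalIntegrable_sq hab)) fun x _ => ?_
    calc ‖f x + g x‖ ^ 2 ≤ (‖f x‖ + ‖g x‖) ^ 2 := by gcongr; exact norm_add_le _ _
      _ = _ := by ring
  rw [intervalIntegral.integral_add ((hf.intervalIntegrable_sq hab).add (hfg.const_mul 2))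
    (hg.intervalIntegrable_sq hab), intervalIntegral.integral_add (hf.intervalIntegrable_sq hab)
    (hfg.const_mul 2), intervalIntegral.integral_const_mul] at this
  linarith

lemma IsL2Primitive.isPrimitive {a b : ℝ} (hab : a ≤ b) {v g : ℝ → ℂ} (h : IsL2Primitive a b v g) :
    IsPrimitive a b v g := ⟨IsL2On.intervalIntegrable hab h.1, h.2⟩

/-! ### Stability and solvability of the Helmholtz problem -/

/-- A solution of `p' = λ p - f` with `Re λ = 0` varies in modulus by at most `∫ |f|`. -/
lemma IsPrimitive.norm_le_of_transport {p d f : ℝ → ℂ} {l : ℂ} (hl : l.re = 0)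
    (hp : IsPrimitive 0 1 p d) (hf : IsL2On 0 1 f)
    (h : ∀ᵐ x ∂(volume.restrict (Ioo (0 : ℝ) 1)), d x = l * p x - f x) {x y : ℝ}
    (hx : x ∈ Icc (0 : ℝ) 1) (hy : y ∈ Icc (0 : ℝ) 1) : ‖p x‖ ≤ ‖p y‖ + l2Norm f := by
  -- Integrating factor; it has modulus one because `l` is purely imaginary.
  have hE : IsPrimitive 0 1 (fun x : ℝ => Complex.exp (-l * x))
      (fun x : ℝ => Complex.exp (-l * x) * (-l)) := by
    refine IsPrimitive.of_hasDerivAt (fun x => ?_) (by fun_prop)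
    have h1 : HasDerivAt (fun x : ℝ => -l * (x : ℂ)) (-l) x := by
      simpa using (Complex.ofRealCLM.hasDerivAt (x := x)).const_mul (-l)
    exact h1.cexp
  have hn : ∀ x : ℝ, ‖Complex.exp (-l * x)‖ = 1 := fun x => by
    rw [Complex.norm_exp]; simp [hl]
  have hEp := hE.mul zero_le_one hp
  have hEp' : IsPrimitive 0 1 (fun x : ℝ => Complex.exp (-l * x) * p x)
      (fun x : ℝ => -(Complex.exp (-l * x) * f x)) := by
    refine hEp.congr_ae zero_le_one ?_
    rw [← restrict_Ioo_eq_restrict_Ioc]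
    filter_upwards [h] with x hx
    rw [hx]; ring
  have hs := hEp'.sub_eq hy hx
  have hint : ‖∫ t in y..x, -(Complex.exp (-l * t) * f t)‖ ≤ l2Norm f := by
    refine intervalIntegral.norm_integral_le_abs_integral_norm.trans ?_
    simp only [norm_neg, norm_mul, hn, one_mul]
    refine le_trans ?_ (integral_norm_le_l2Norm hf)
    have hfi := (hf.intervalIntegrable zero_le_one).norm
    rw [intervalIntegral.abs_integral_eq_abs_integral_uIoc, abs_of_nonneg
      (integral_nonneg fun _ => norm_nonneg _), intervalIntegral.integral_of_le zero_le_one]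
    refine setIntegral_mono_set hfi.1 (Eventually.of_forall fun _ => norm_nonneg _) ?_
    refine LE.le.eventuallyLE (fun z hz => ?_)
    rw [mem_uIoc] at hz
    rcases hz with hz | hz
    · exact ⟨hy.1.trans_lt hz.1, hz.2.trans hx.2⟩
    · exact ⟨hx.1.trans_lt hz.1, hz.2.trans hy.2⟩
  calc ‖p x‖ = ‖Complex.exp (-l * x) * p x‖ := by rw [norm_mul, hn, one_mul]
    _ = ‖Complex.exp (-l * y) * p y + ∫ t in y..x, -(Complex.exp (-l * t) * f t)‖ := by
        rw [← hs]; congr 1; ring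
    _ ≤ ‖Complex.exp (-l * y) * p y‖ + l2Norm f := (norm_add_le _ _).trans (by gcongr)
    _ = _ := by rw [norm_mul, hn, one_mul]

/-- The data of a solution of the Helmholtz problem, with the derivatives made explicit. -/
structure HelmholtzData (k : ℝ) (f u du d2u : ℝ → ℂ) : Prop where
  prim : IsL2Primitive 0 1 u du
  prim' : IsL2Primitive 0 1 du d2u
  eqn : ∀ᵐ x ∂(volume.restrict (Ioo (0 : ℝ) 1)), d2u x + (k : ℂ) ^ 2 * u x = - f x
  left : u 0 = 0
  right : du 1 = Complex.I * k * u 1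

lemma IsHelmholtzSolution.exists_data {k : ℝ} {f u : ℝ → ℂ} (h : IsHelmholtzSolution k f u) :
    ∃ du d2u, HelmholtzData k f u du d2u := by
  obtain ⟨du, d2u, h1, h2, h3, h4, h5⟩ := h
  exact ⟨du, d2u, h1, h2, h3, h4, sub_eq_zero.1 h5⟩

namespace HelmholtzData

variable {k : ℝ} {f u du d2u : ℝ → ℂ}

lemma isPrimitive (h : HelmholtzData k f u du d2u) : IsPrimitive 0 1 u du :=
  h.prim.isPrimitive zero_le_one

lemma isPrimitive' (h : HelmholtzData k f u du d2u) : IsPrimitive 0 1 du d2u :=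
  h.prim'.isPrimitive zero_le_one

/-- The equation factors as (d/dx ± ik)(u' ∓ iku) = -f. The outgoing characteristic u' - iku
vanishes at 1 and is transported leftwards; at 0 both characteristics equal u'(0) since u(0) = 0,
and the other one is transported back. Half sum and half difference give the constant 3/2 for u' and
ku. -/
lemma norm_characteristics_le (h : HelmholtzData k f u du d2u) (hf : IsL2On 0 1 f) {x : ℝ}
    (hx : x ∈ Icc (0 : ℝ) 1) :
    ‖du x + -(Complex.I * k) * u x‖ ≤ l2Norm f ∧
      ‖du x + Complex.I * k * u x‖ ≤ 2 * l2Norm f := by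
  have hA := h.isPrimitive'.add (h.isPrimitive.const_mul (-(Complex.I * k)))
  have hB := h.isPrimitive'.add (h.isPrimitive.const_mul (Complex.I * k))
  have h1 : ∀ y ∈ Icc (0 : ℝ) 1, ‖du y + -(Complex.I * k) * u y‖ ≤ l2Norm f := fun y hy => by
    have := hA.norm_le_of_transport (f := f) (l := -(Complex.I * k)) (by simp) hf (by
      filter_upwards [h.eqn] with x hx
      linear_combination hx - (k : ℂ) ^ 2 * u x * Complex.I_sq) hy (y := 1) (by simp)
    have h0 : du 1 + -(Complex.I * k) * u 1 = 0 := by rw [h.right]; ring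
    rwa [h0, norm_zero, zero_add] at this
  refine ⟨h1 x hx, ?_⟩
  have := hB.norm_le_of_transport (f := f) (l := Complex.I * k) (by simp) hf (by
      filter_upwards [h.eqn] with x hx
      linear_combination hx - (k : ℂ) ^ 2 * u x * Complex.I_sq) hx (y := 0) (by simp)
  have h2 := h1 0 (by simp)
  simp only [h.left, mul_zero, add_zero] at this h2
  linarith

lemma norm_du_le (h : HelmholtzData k f u du d2u) (hf : IsL2On 0 1 f) {x : ℝ}
    (hx : x ∈ Icc (0 : ℝ) 1) : ‖du x‖ ≤ 3 / 2 * l2Norm f := by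
  obtain ⟨h1, h2⟩ := h.norm_characteristics_le hf hx
  have : (2 : ℂ) * du x = (du x + -(Complex.I * k) * u x) + (du x + Complex.I * k * u x) := by ring
  have h3 : ‖(2 : ℂ) * du x‖ ≤ 3 * l2Norm f := by
    rw [this]; exact (norm_add_le _ _).trans (by linarith)
  rw [norm_mul, Complex.norm_ofNat] at h3
  linarith

lemma norm_le (h : HelmholtzData k f u du d2u) (hk : 0 ≤ k) (hf : IsL2On 0 1 f) {x : ℝ}
    (hx : x ∈ Icc (0 : ℝ) 1) : k * ‖u x‖ ≤ 3 / 2 * l2Norm f := by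
  obtain ⟨h1, h2⟩ := h.norm_characteristics_le hf hx
  have : 2 * Complex.I * k * u x =
    (du x + Complex.I * k * u x) - (du x + -(Complex.I * k) * u x) := by ring
  have h3 : ‖2 * Complex.I * k * u x‖ ≤ 3 * l2Norm f := by
    rw [this]; exact (norm_sub_le _ _).trans (by linarith)
  rw [norm_mul, norm_mul, norm_mul, Complex.norm_I, Complex.norm_real, Complex.norm_ofNat,
    Real.norm_of_nonneg hk] at h3
  linarith

lemma isL2On (h : HelmholtzData k f u du d2u) : IsL2On 0 1 u :=
  IsL2On.of_continuousOn (h.isPrimitive.continuousOn zero_le_one)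

lemma l2Norm_le (h : HelmholtzData k f u du d2u) (hk : 0 ≤ k) (hf : IsL2On 0 1 f) :
    k * l2Norm u ≤ 3 / 2 * l2Norm f := by
  have hF := l2Norm_nonneg f
  have h1 : l2Norm (fun x => (k : ℂ) * u x) ≤ 3 / 2 * l2Norm f := by
    refine l2Norm_le_of_bound (by positivity) (fun x hx => ?_) (MemLp.const_mul h.isL2On _)
    rw [norm_mul, Complex.norm_real, Real.norm_of_nonneg hk]
    exact h.norm_le hk hf hx
  rwa [l2Norm_const_mul, Complex.norm_real, Real.norm_of_nonneg hk] at h1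

/-- Read off from u'' = -(k²u + f); the constant is 3/2 + 1, using `1 ≤ k`. -/
lemma l2Norm_d2u_le (h : HelmholtzData k f u du d2u) (hk : 1 ≤ k) (hf : IsL2On 0 1 f) :
    l2Norm d2u ≤ 5 / 2 * k * l2Norm f := by
  have hF := l2Norm_nonneg f
  have h1 : l2Norm d2u = l2Norm (fun x => (k : ℂ) ^ 2 * u x + f x) := by
    refine l2Norm_congr ((ae_restrict_iff' measurableSet_Ioc).1 ?_)
    rw [← restrict_Ioo_eq_restrict_Ioc]
    filter_upwards [h.eqn] with x hx
    rw [← norm_neg]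
    congr 1
    linear_combination -hx
  rw [h1]
  refine (l2Norm_add_le (MemLp.const_mul h.isL2On _) hf).trans ?_
  rw [l2Norm_const_mul, norm_pow, Complex.norm_real, Real.norm_of_nonneg (by linarith)]
  have := h.l2Norm_le (by linarith) hf
  nlinarith

end HelmholtzData

/-- Variation of parameters: the Green function is sin(k min(x,t)) exp(ik max(x,t)) / k. Continuous
data suffice, since the dual problem has a piecewise linear right-hand side. -/
lemma exists_helmholtzData {k : ℝ} (hk : k ≠ 0) {f : ℝ → ℂ} (hf : ContinuousOn f (Icc 0 1)) :
    ∃ u du d2u, HelmholtzData k f u du d2u := by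
  -- Constant extension beyond the interval, so that all derivatives below exist on the whole line.
  set g : ℝ → ℂ := fun x => f (projIcc (0 : ℝ) 1 zero_le_one x) with hg
  have hgc : Continuous g := by
    have := hf.domRestrict
    exact this.comp continuous_projIcc
  have hgf : ∀ x ∈ Icc (0 : ℝ) 1, g x = f x := fun x hx => by simp [hg, projIcc_of_mem _ hx]
  have hkc : (k : ℂ) ≠ 0 := by exact_mod_cast hk
  set e : ℝ → ℂ := fun x => Complex.exp (Complex.I * k * x)
  set s : ℝ → ℂ := fun x => Complex.sin (k * x)
  set c : ℝ → ℂ := fun x => Complex.cos (k * x)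
  have hcast : ∀ x : ℝ, HasDerivAt (fun x : ℝ => (k : ℂ) * x) k x := fun x => by
    simpa using (Complex.ofRealCLM.hasDerivAt (x := x)).const_mul (k : ℂ)
  have he : ∀ x, HasDerivAt e (Complex.I * k * e x) x := fun x => by
    have h1 : HasDerivAt (fun x : ℝ => Complex.I * k * (x : ℂ)) (Complex.I * k) x := by
      simpa using (Complex.ofRealCLM.hasDerivAt (x := x)).const_mul (Complex.I * k)
    exact h1.cexp.congr_deriv (mul_comm _ _)
  have hs : ∀ x, HasDerivAt s (k * c x) x := fun x => by
    exact ((Complex.hasDerivAt_sin (k * x)).comp x (hcast x)).congr_deriv (mul_comm _ _)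
  have hc : ∀ x, HasDerivAt c (-(k * s x)) x := fun x => by
    refine ((Complex.hasDerivAt_cos (k * x)).comp x (hcast x)).congr_deriv ?_
    simp only [s]
    ring
  have hec : Continuous e := by fun_prop
  have hsc : Continuous s := by fun_prop
  have hcc : Continuous c := by fun_prop
  set G : ℝ → ℂ := fun x => ∫ t in (0 : ℝ)..x, s t * g t
  set H : ℝ → ℂ := fun x => ∫ t in (0 : ℝ)..x, e t * g t
  have hG : ∀ x, HasDerivAt G (s x * g x) x := fun x =>
    (hsc.mul hgc).integral_hasStrictDerivAt 0 x |>.hasDerivAt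
  have hH : ∀ x, HasDerivAt H (e x * g x) x := fun x =>
    (hec.mul hgc).integral_hasStrictDerivAt 0 x |>.hasDerivAt
  have hGc : Continuous G := continuous_iff_continuousAt.2 fun x => (hG x).continuousAt
  have hHc : Continuous H := continuous_iff_continuousAt.2 fun x => (hH x).continuousAt
  have hexp : ∀ x, e x = c x + s x * Complex.I := fun x => by
    simp only [e, c, s]
    rw [← Complex.exp_mul_I]; congr 1; ring
  have hcs : ∀ x, s x ^ 2 + c x ^ 2 = 1 := fun x => Complex.sin_sq_add_cos_sq _
  set u : ℝ → ℂ := fun x => (k : ℂ)⁻¹ * (e x * G x + s x * (H 1 - H x))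
  set du : ℝ → ℂ := fun x => Complex.I * e x * G x + c x * (H 1 - H x)
  set d2u : ℝ → ℂ := fun x => -(k : ℂ) ^ 2 * u x - g x
  have hu : ∀ x, HasDerivAt u (du x) x := fun x => by
    have := (((he x).mul (hG x)).add ((hs x).mul ((hH x).const_sub (H 1)))).const_mul (k : ℂ)⁻¹
    refine this.congr_deriv ?_
    simp only [du]
    field_simp
    ring
  have hdu : ∀ x, HasDerivAt du (d2u x) x := fun x => by
    have := (((he x).const_mul Complex.I).mul (hG x)).add
      ((hc x).mul ((hH x).const_sub (H 1)))
    refine this.congr_deriv ?_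
    simp only [d2u, u]
    field_simp
    have h1 := hexp x
    have h2 := hcs x
    have h3 := Complex.I_sq
    rw [h1]
    linear_combination (G x * k * (c x + s x * Complex.I) + s x ^ 2 * g x) * h3 - g x * h2
  have huc : Continuous u := by fun_prop
  have hduc : Continuous du := by fun_prop
  have hd2c : Continuous d2u := by fun_prop
  refine ⟨u, du, d2u, ⟨IsL2On.of_continuousOn hduc.continuousOn,
    (IsPrimitive.of_hasDerivAt hu hduc).2⟩, ⟨IsL2On.of_continuousOn hd2c.continuousOn,
    (IsPrimitive.of_hasDerivAt hdu hd2c).2⟩, ?_, ?_, ?_⟩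
  · filter_upwards [ae_restrict_mem measurableSet_Ioo] with x hx
    rw [← hgf x (Ioo_subset_Icc_self hx)]
    simp only [d2u]; ring
  · simp [u, G, s]
  · simp only [u, du]
    field_simp
    ring

/-! ### The mesh and piecewise linear functions -/

/-- Slope of the piecewise linear function with nodal values `U` on cell `j`. -/
noncomputable def cellSlope (n : ℕ) (U : ℕ → ℂ) (j : ℕ) : ℂ := n * (U (j + 1) - U j)

/-- The piecewise linear function with value `U j` at `node n j`. -/
noncomputable def pl (n : ℕ) (U : ℕ → ℂ) (x : ℝ) : ℂ :=
  U ⌊n * x⌋₊ + (n * x - ⌊n * x⌋₊) * (U (⌊n * x⌋₊ + 1) - U ⌊n * x⌋₊)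

/-- The derivative of `pl n U`. -/
noncomputable def plDeriv (n : ℕ) (U : ℕ → ℂ) (x : ℝ) : ℂ := cellSlope n U ⌊n * x⌋₊

/-- The closed mesh cell with index `j`. -/
abbrev cell (n j : ℕ) : Set ℝ := Icc (node n j) (node n (j + 1))

variable {n : ℕ} {U V : ℕ → ℂ}

lemma node_zero : node n 0 = 0 := by simp [node]

lemma node_self (hn : 0 < n) : node n n = 1 := by
  have : (n : ℝ) ≠ 0 := by positivity
  simp [node, this]

lemma node_succ_sub (j : ℕ) : node n (j + 1) - node n j = 1 / n := by
  simp only [node]; push_cast; ring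

lemma node_lt_succ (hn : 0 < n) (j : ℕ) : node n j < node n (j + 1) := by
  have := node_succ_sub (n := n) j
  have : (0 : ℝ) < 1 / n := by positivity
  linarith

lemma node_le_succ (j : ℕ) : node n j ≤ node n (j + 1) := by
  have := node_succ_sub (n := n) j
  have : (0 : ℝ) ≤ 1 / n := by positivity
  linarith

lemma mul_node (hn : 0 < n) (j : ℕ) : (n : ℝ) * node n j = j := by
  have : (n : ℝ) ≠ 0 := by positivity
  simp only [node]; field_simp

lemma node_mem_Icc {j : ℕ} (hj : j ≤ n) : node n j ∈ Icc (0 : ℝ) 1 := by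
  refine ⟨by simp only [node]; positivity, ?_⟩
  exact div_le_one_of_le₀ (by exact_mod_cast hj) (by positivity)

lemma cell_subset {j : ℕ} (hj : j < n) : cell n j ⊆ Icc 0 1 :=
  Icc_subset_Icc (node_mem_Icc hj.le).1 (node_mem_Icc hj).2

lemma left_mem_cell (j : ℕ) : node n j ∈ cell n j := ⟨le_rfl, node_le_succ j⟩

lemma right_mem_cell (j : ℕ) : node n (j + 1) ∈ cell n j := ⟨node_le_succ j, le_rfl⟩

lemma floor_eq_of_mem (hn : 0 < n) {j : ℕ} {x : ℝ} (hx : x ∈ Ico (node n j) (node n (j + 1))) :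
    ⌊n * x⌋₊ = j := by
  have hn' : (0 : ℝ) < n := by exact_mod_cast hn
  have h1 := mul_node hn j
  have h2 := mul_node hn (j + 1)
  push_cast at h2
  have h3 : (n : ℝ) * node n j ≤ n * x := by gcongr; exact hx.1
  have h4 : (n : ℝ) * x < n * node n (j + 1) := by gcongr; exact hx.2
  rw [Nat.floor_eq_iff (by rw [h1] at h3; exact le_trans (by positivity) h3)]
  exact ⟨by linarith, by linarith⟩

lemma exists_cell (hn : 0 < n) {x : ℝ} (hx : x ∈ Icc (0 : ℝ) 1) : ∃ j < n, x ∈ cell n j := by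
  have hn' : (0 : ℝ) < n := by exact_mod_cast hn
  rcases hx.2.eq_or_lt with rfl | h1
  · obtain ⟨m, rfl⟩ := Nat.exists_eq_succ_of_ne_zero hn.ne'
    refine ⟨m, by simp, ?_⟩
    have := right_mem_cell (n := m + 1) m
    rwa [node_self hn] at this
  · have h0 : (0 : ℝ) ≤ n * x := mul_nonneg hn'.le hx.1
    refine ⟨⌊n * x⌋₊, (Nat.floor_lt h0).2 (by nlinarith), ?_, ?_⟩
    · simp only [node]
      rw [div_le_iff₀ hn', mul_comm x]
      exact Nat.floor_le h0
    · simp only [node]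
      rw [le_div_iff₀ hn', mul_comm x]
      push_cast
      exact (Nat.lt_floor_add_one _).le

lemma pl_eq (hn : 0 < n) {j : ℕ} {x : ℝ} (hx : x ∈ cell n j) :
    pl n U x = U j + (n * x - j) * (U (j + 1) - U j) := by
  rcases hx.2.eq_or_lt with h | h
  · have h1 : ⌊n * x⌋₊ = j + 1 := by
      rw [h, mul_node hn]; exact Nat.floor_natCast _
    have h2 : (n : ℂ) * x = (j + 1 : ℕ) := by
      rw [h]; exact_mod_cast mul_node hn (j + 1)
    rw [pl, h1, h2]; push_cast; ring
  · rw [pl, floor_eq_of_mem hn ⟨hx.1, h⟩]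

lemma pl_node (hn : 0 < n) (j : ℕ) : pl n U (node n j) = U j := by
  rw [pl_eq hn (left_mem_cell j)]
  have : (n : ℂ) * node n j = j := by exact_mod_cast mul_node hn j
  rw [this]; ring

lemma pl_zero (hn : 0 < n) : pl n U 0 = U 0 := by
  simpa [node_zero] using pl_node (U := U) hn 0

lemma pl_one (hn : 0 < n) : pl n U 1 = U n := by
  simpa [node_self hn] using pl_node (U := U) hn n

lemma plDeriv_eq (hn : 0 < n) {j : ℕ} {x : ℝ} (hx : x ∈ Ico (node n j) (node n (j + 1))) :
    plDeriv n U x = cellSlope n U j := by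
  rw [plDeriv, floor_eq_of_mem hn hx]

lemma pl_add (x : ℝ) : pl n (fun j => U j + V j) x = pl n U x + pl n V x := by
  simp only [pl]; ring

lemma pl_sub (x : ℝ) : pl n (fun j => U j - V j) x = pl n U x - pl n V x := by
  simp only [pl]; ring

lemma pl_const_mul (c : ℂ) (x : ℝ) : pl n (fun j => c * U j) x = c * pl n U x := by
  simp only [pl]; ring

lemma pl_conj (x : ℝ) : pl n (fun j => conj (U j)) x = conj (pl n U x) := by
  simp [pl]

lemma cellSlope_conj (j : ℕ) : cellSlope n (fun j => conj (U j)) j = conj (cellSlope n U j) := by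
  simp [cellSlope]

lemma cellSlope_sub (j : ℕ) : cellSlope n (fun j => U j - V j) j = cellSlope n U j - cellSlope n V j := by
  simp only [cellSlope]; ring

lemma integral_congr_cell {E : Type*} [NormedAddCommGroup E] [NormedSpace ℝ E]
    {j : ℕ} {F G : ℝ → E}
    (h : ∀ x ∈ Ioo (node n j) (node n (j + 1)), F x = G x) :
    ∫ x in node n j..node n (j + 1), F x = ∫ x in node n j..node n (j + 1), G x := by
  rw [intervalIntegral.integral_of_le (node_le_succ j),
    intervalIntegral.integral_of_le (node_le_succ j), integral_Ioc_eq_integral_Ioo,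
    integral_Ioc_eq_integral_Ioo]
  exact setIntegral_congr_fun measurableSet_Ioo h

lemma integral_eq_sum_cells (hn : 0 < n) {E : Type*} [NormedAddCommGroup E] [NormedSpace ℝ E]
    {F : ℝ → E} (hF : IntervalIntegrable F volume 0 1) :
    ∫ x in (0 : ℝ)..1, F x = ∑ j ∈ Finset.range n, ∫ x in node n j..node n (j + 1), F x := by
  rw [intervalIntegral.sum_integral_adjacent_intervals, node_zero, node_self hn]
  intro j hj
  refine hF.mono_set ?_
  rw [uIcc_of_le (node_le_succ j), uIcc_of_le zero_le_one]
  exact cell_subset hj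

lemma plDeriv_isL2On (hn : 0 < n) : IsL2On 0 1 (plDeriv n U) := by
  refine MemLp.of_bound (C := ∑ j ∈ Finset.range n, ‖cellSlope n U j‖) ?_ ?_
  · refine Measurable.aestronglyMeasurable ?_
    have : Measurable (cellSlope n U) := measurable_from_nat
    exact this.comp (Nat.measurable_floor.comp (measurable_const.mul measurable_id))
  · filter_upwards [ae_restrict_mem measurableSet_Ioo] with x hx
    have h0 : (0 : ℝ) ≤ n * x := mul_nonneg (by positivity) hx.1.le
    have hn' : (0 : ℝ) < n := by exact_mod_cast hn
    have : ⌊n * x⌋₊ ∈ Finset.range n :=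
      Finset.mem_range.2 ((Nat.floor_lt h0).2 (by nlinarith [hx.2]))
    exact Finset.single_le_sum (f := fun j => ‖cellSlope n U j‖) (fun _ _ => norm_nonneg _) this

lemma isPrimitive_of_affine_cell {v g : ℝ → ℂ} {a s x₀ : ℂ} {α β : ℝ} (hab : α ≤ β)
    (hv : ∀ x ∈ Icc α β, v x = a + s * (x - x₀)) (hg : ∀ x ∈ Ioo α β, g x = s) :
    IsPrimitive α β v g := by
  have h1 : IsPrimitive α β v (fun _ => s) := by
    refine ⟨by simp, fun x hx => ?_⟩
    rw [hv x hx, hv α ⟨le_rfl, hab⟩]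
    simp
    ring
  refine h1.congr_ae hab ?_
  rw [← restrict_Ioo_eq_restrict_Ioc]
  filter_upwards [ae_restrict_mem measurableSet_Ioo] with x hx using (hg x hx).symm

lemma isPrimitive_pl (hn : 0 < n) : IsPrimitive 0 1 (pl n U) (plDeriv n U) := by
  have h : ∀ m, IsPrimitive 0 (node n m) (pl n U) (plDeriv n U) := by
    intro m
    induction m with
    | zero =>
      rw [node_zero]
      refine ⟨by simp, fun x hx => ?_⟩
      obtain rfl : x = 0 := by simpa using hx
      simp
    | succ m ih =>
      refine ih.trans (by simp only [node]; positivity) (node_le_succ m)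
        (isPrimitive_of_affine_cell (a := U m) (s := cellSlope n U m) (x₀ := node n m)
          (node_le_succ m) (fun x hx => ?_) fun x hx => plDeriv_eq hn (Ioo_subset_Ico_self hx))
      rw [pl_eq hn hx, cellSlope]
      have : (n : ℂ) * node n m = m := by exact_mod_cast mul_node hn m
      rw [← this]; ring
  simpa [node_self hn] using h n

lemma pl_continuousOn (hn : 0 < n) : ContinuousOn (pl n U) (Icc 0 1) :=
  (isPrimitive_pl hn).continuousOn zero_le_one

lemma pl_isL2On (hn : 0 < n) : IsL2On 0 1 (pl n U) := IsL2On.of_continuousOn (pl_continuousOn hn)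

lemma pl_norm_le (hn : 0 < n) {C : ℝ} (hU : ∀ j ≤ n, ‖U j‖ ≤ C) {x : ℝ} (hx : x ∈ Icc (0 : ℝ) 1) :
    ‖pl n U x‖ ≤ C := by
  obtain ⟨j, hj, hxj⟩ := exists_cell hn hx
  have hn' : (0 : ℝ) < n := by exact_mod_cast hn
  have h1 := mul_node hn j
  have h2 := mul_node hn (j + 1)
  push_cast at h2
  have h3 : (n : ℝ) * node n j ≤ n * x := by gcongr; exact hxj.1
  have h4 : (n : ℝ) * x ≤ n * node n (j + 1) := by gcongr; exact hxj.2
  have h5 : pl n U x = ((1 - (n * x - j) : ℝ) : ℂ) * U j + ((n * x - j : ℝ) : ℂ) * U (j + 1) := by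
    rw [pl_eq hn hxj]; push_cast; ring
  rw [h5]
  refine (norm_add_le _ _).trans ?_
  rw [norm_mul, norm_mul, Complex.norm_real, Complex.norm_real, Real.norm_of_nonneg (by linarith),
    Real.norm_of_nonneg (by linarith)]
  have h6 := hU j hj.le
  have h7 := hU (j + 1) hj
  nlinarith

/-- The slope of the test function is constant on a cell, so only the increment of `u` across the
cell matters: nodal interpolation is the orthogonal projection for the derivative inner product. -/
lemma integral_mul_plDeriv (hn : 0 < n) {u du : ℝ → ℂ} (hu : IsPrimitive 0 1 u du) :
    ∫ x in (0 : ℝ)..1, du x * plDeriv n V x =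
      1 / (n : ℂ) * ∑ j ∈ Finset.range n, cellSlope n (fun j => u (node n j)) j * cellSlope n V j := by
  have hn' : (n : ℂ) ≠ 0 := by exact_mod_cast hn.ne'
  have hint : IntervalIntegrable (fun x => du x * plDeriv n V x) volume 0 1 := by
    have h1 : ∀ j < n, IntervalIntegrable (fun x => du x * plDeriv n V x) volume
        (node n j) (node n (j + 1)) := fun j hj => by
      have hdu := IsPrimitive.intervalIntegrable_subinterval hu.1 (node_mem_Icc hj.le)
        (node_mem_Icc hj)
      refine (hdu.mul_const (cellSlope n V j)).congr_ae ?_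
      rw [uIoc_of_le (node_le_succ j), ← restrict_Ioo_eq_restrict_Ioc]
      filter_upwards [ae_restrict_mem measurableSet_Ioo] with x hx
      rw [plDeriv_eq hn (Ioo_subset_Ico_self hx)]
    have := IntervalIntegrable.trans_iterate h1
    rwa [node_zero, node_self hn] at this
  rw [integral_eq_sum_cells hn hint, Finset.mul_sum]
  refine Finset.sum_congr rfl fun j hj => ?_
  have hj' := Finset.mem_range.1 hj
  rw [integral_congr_cell (G := fun x => du x * cellSlope n V j) fun x hx => by
    rw [plDeriv_eq hn (Ioo_subset_Ico_self hx)], intervalIntegral.integral_mul_const,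
    ← hu.sub_eq (node_mem_Icc hj'.le) (node_mem_Icc hj')]
  simp only [cellSlope]
  field_simp

lemma integral_plDeriv_mul_plDeriv (hn : 0 < n) :
    ∫ x in (0 : ℝ)..1, plDeriv n U x * plDeriv n V x =
      1 / (n : ℂ) * ∑ j ∈ Finset.range n, cellSlope n U j * cellSlope n V j := by
  rw [integral_mul_plDeriv hn (isPrimitive_pl hn)]
  simp only [pl_node hn]

/-- Weak form of the Helmholtz problem, tested with piecewise linear functions. -/
lemma HelmholtzData.weak_form {k : ℝ} {f u du d2u : ℝ → ℂ} (h : HelmholtzData k f u du d2u)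
    (hn : 0 < n) (hV : V 0 = 0) :
    ∫ x in (0 : ℝ)..1, f x * pl n V x =
      1 / (n : ℂ) * ∑ j ∈ Finset.range n, cellSlope n (fun j => u (node n j)) j * cellSlope n V j
        - k ^ 2 * (∫ x in (0 : ℝ)..1, u x * pl n V x) - Complex.I * k * u 1 * V n := by
  -- Integration by parts of u' against the test function; the term at 0 vanishes and the one at 1
  -- is the impedance term.
  have hp := h.isPrimitive'.mul zero_le_one (isPrimitive_pl (U := V) hn)
  have h1 := hp.sub_eq (x := 0) (y := 1) (by simp) (by simp)
  have hc : ContinuousOn (pl n V) (uIcc 0 1) := by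
    rw [uIcc_of_le zero_le_one]; exact pl_continuousOn hn
  have hi1 := h.isPrimitive'.1.mul_continuousOn hc
  have hi3 : IntervalIntegrable (fun x => u x * pl n V x) volume 0 1 :=
    ContinuousOn.intervalIntegrable (by
      refine ContinuousOn.mul ?_ hc
      rw [uIcc_of_le zero_le_one]; exact h.isPrimitive.continuousOn zero_le_one)
  have hi2 : IntervalIntegrable (fun x => du x * plDeriv n V x) volume 0 1 :=
    (isPrimitive_pl (U := V) hn).1.continuousOn_mul (by
      rw [uIcc_of_le zero_le_one]; exact h.isPrimitive'.continuousOn zero_le_one)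
  rw [intervalIntegral.integral_add hi1 hi2, integral_mul_plDeriv hn h.isPrimitive, pl_one hn,
    pl_zero hn, hV, h.right, mul_zero, sub_zero] at h1
  have h2 : ∫ x in (0 : ℝ)..1, f x * pl n V x =
      ∫ x in (0 : ℝ)..1, (-(d2u x * pl n V x) - (k : ℂ) ^ 2 * (u x * pl n V x)) := by
    refine intervalIntegral.integral_congr_ae ?_
    rw [uIoc_of_le zero_le_one]
    refine (ae_restrict_iff' measurableSet_Ioc).1 ?_
    rw [← restrict_Ioo_eq_restrict_Ioc]
    filter_upwards [h.eqn] with x hx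
    linear_combination pl n V x * hx
  have hi1' : IntervalIntegrable (fun x => -(d2u x * pl n V x)) volume 0 1 := hi1.neg
  rw [h2, intervalIntegral.integral_sub hi1' (hi3.const_mul _), intervalIntegral.integral_neg,
    intervalIntegral.integral_const_mul]
  linear_combination h1

/-! ### Slope jumps and interpolation errors -/

/-- The jump of the derivative of `pl n U` at `node n (j + 1)`, with the impedance residual
at the right endpoint. -/
noncomputable def slopeJump (k : ℝ) (n : ℕ) (U : ℕ → ℂ) (j : ℕ) : ℂ :=
  if j + 1 < n then cellSlope n U j - cellSlope n U (j + 1)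
  else cellSlope n U j - Complex.I * k * U n

section Interpolation

variable {u du d2u : ℝ → ℂ}

lemma sq_integral_norm_cell_le (hd : IsL2On 0 1 d2u) {j : ℕ} (hj : j < n) :
    (∫ x in node n j..node n (j + 1), ‖d2u x‖) ^ 2 ≤
      1 / n * ∫ x in node n j..node n (j + 1), ‖d2u x‖ ^ 2 := by
  have := (hd.mono (node_mem_Icc hj.le).1 (node_mem_Icc hj).2).integral_norm_sq_le (node_le_succ j)
  rwa [node_succ_sub] at this

lemma norm_sub_le_cell (h : IsPrimitive 0 1 du d2u) {j : ℕ} (hj : j < n) {x y : ℝ}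
    (hx : x ∈ cell n j) (hy : y ∈ cell n j) :
    ‖du x - du y‖ ≤ ∫ t in node n j..node n (j + 1), ‖d2u t‖ := by
  have hi := (IsPrimitive.intervalIntegrable_subinterval h.1 (node_mem_Icc hj.le)
    (node_mem_Icc hj)).norm
  rw [h.sub_eq (cell_subset hj hy) (cell_subset hj hx)]
  refine intervalIntegral.norm_integral_le_abs_integral_norm.trans ?_
  rw [intervalIntegral.abs_integral_eq_abs_integral_uIoc, abs_of_nonneg
    (integral_nonneg fun _ => norm_nonneg _), intervalIntegral.integral_of_le (node_le_succ j)]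
  refine setIntegral_mono_set hi.1 (Eventually.of_forall fun _ => norm_nonneg _) ?_
  refine LE.le.eventuallyLE (fun z hz => ?_)
  rw [mem_uIoc] at hz
  rcases hz with hz | hz
  · exact ⟨hy.1.trans_lt hz.1, hz.2.trans hx.2⟩
  · exact ⟨hx.1.trans_lt hz.1, hz.2.trans hy.2⟩

/-- The slope of the interpolant is the mean of `du` over the cell, so the difference is the mean of
`du x - du y`. -/
lemma norm_cellSlope_sub_le (hn : 0 < n) (hu : IsPrimitive 0 1 u du) (h : IsPrimitive 0 1 du d2u)
    {j : ℕ} (hj : j < n) {x : ℝ} (hx : x ∈ cell n j) :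
    ‖du x - cellSlope n (fun i => u (node n i)) j‖ ≤
      ∫ t in node n j..node n (j + 1), ‖d2u t‖ := by
  have hn' : (0 : ℝ) < n := by exact_mod_cast hn
  have hi := IsPrimitive.intervalIntegrable_subinterval hu.1 (node_mem_Icc hj.le) (node_mem_Icc hj)
  have h1 : (1 / n : ℝ) • (du x - cellSlope n (fun i => u (node n i)) j) =
      ∫ y in node n j..node n (j + 1), (du x - du y) := by
    rw [intervalIntegral.integral_sub (by simp) hi, intervalIntegral.integral_const,
      node_succ_sub, ← hu.sub_eq (node_mem_Icc hj.le) (node_mem_Icc hj), smul_sub]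
    congr 1
    have hnc : (n : ℂ) ≠ 0 := by exact_mod_cast hn.ne'
    simp only [cellSlope, Complex.real_smul]
    push_cast
    field_simp
  have h2 := intervalIntegral.norm_integral_le_of_norm_le_const
    (C := ∫ t in node n j..node n (j + 1), ‖d2u t‖) (f := fun y => du x - du y)
    (a := node n j) (b := node n (j + 1)) fun y hy => by
      rw [uIoc_of_le (node_le_succ j)] at hy
      exact norm_sub_le_cell h hj hx ⟨hy.1.le, hy.2⟩
  rw [← h1, norm_smul, node_succ_sub, abs_of_pos (by positivity),
    Real.norm_of_nonneg (by positivity), mul_comm] at h2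
  exact le_of_mul_le_mul_right h2 (by positivity)

/-- The interpolation error vanishes at the left node and its derivative is the slope error. -/
lemma norm_sub_pl_le (hn : 0 < n) (hu : IsPrimitive 0 1 u du) (h : IsPrimitive 0 1 du d2u)
    {j : ℕ} (hj : j < n) {x : ℝ} (hx : x ∈ cell n j) :
    ‖u x - pl n (fun i => u (node n i)) x‖ ≤
      1 / n * ∫ t in node n j..node n (j + 1), ‖d2u t‖ := by
  have hn' : (0 : ℝ) < n := by exact_mod_cast hn
  have hI0 : 0 ≤ ∫ t in node n j..node n (j + 1), ‖d2u t‖ :=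
    intervalIntegral.integral_nonneg (node_le_succ j) fun _ _ => norm_nonneg _
  have hi := IsPrimitive.intervalIntegrable_subinterval hu.1 (node_mem_Icc hj.le) (cell_subset hj hx)
  have h1 : u x - pl n (fun i => u (node n i)) x =
      ∫ y in node n j..x, (du y - cellSlope n (fun i => u (node n i)) j) := by
    rw [intervalIntegral.integral_sub hi (by simp), intervalIntegral.integral_const,
      ← hu.sub_eq (node_mem_Icc hj.le) (cell_subset hj hx), pl_eq hn hx, cellSlope]
    have : (n : ℂ) * node n j = j := by exact_mod_cast mul_node hn j
    rw [← this, Complex.real_smul]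
    push_cast
    ring
  rw [h1]
  refine (intervalIntegral.norm_integral_le_of_norm_le_const
    (C := ∫ t in node n j..node n (j + 1), ‖d2u t‖) fun y hy => ?_).trans ?_
  · rw [uIoc_of_le hx.1] at hy
    exact norm_cellSlope_sub_le hn hu h hj ⟨hy.1.le, hy.2.trans hx.2⟩
  · rw [mul_comm, abs_of_nonneg (by linarith [hx.1])]
    have := node_succ_sub (n := n) j
    gcongr
    linarith [hx.2]

/-- The extra factor `1 / n` combines two square roots: the cell length from integrating a constant,
and Cauchy–Schwarz for ∫‖d‖ on the cell. -/
lemma l2Norm_le_of_cell_bound (hn : 0 < n) {v d : ℝ → ℂ} (hv : IsL2On 0 1 v) (hd : IsL2On 0 1 d)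
    {c : ℝ} (hc : 0 ≤ c)
    (hvd : ∀ j < n, ∀ x ∈ Ioo (node n j) (node n (j + 1)),
      ‖v x‖ ≤ c * ∫ t in node n j..node n (j + 1), ‖d t‖) :
    l2Norm v ≤ c * (1 / n) * l2Norm d := by
  have hn' : (0 : ℝ) < n := by exact_mod_cast hn
  refine abs_le_of_sq_le_sq' ?_ (mul_nonneg (by positivity) (l2Norm_nonneg _)) |>.2
  rw [mul_pow, l2Norm_sq, l2Norm_sq, integral_eq_sum_cells hn (hv.intervalIntegrable_sq zero_le_one),
    integral_eq_sum_cells hn (hd.intervalIntegrable_sq zero_le_one), Finset.mul_sum]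
  refine Finset.sum_le_sum fun j hj => ?_
  have hj' := Finset.mem_range.1 hj
  have h1 := sq_integral_norm_cell_le hd hj'
  have hvj := (hv.mono (node_mem_Icc hj'.le).1 (node_mem_Icc hj').2).intervalIntegrable_sq
    (node_le_succ j)
  calc ∫ x in node n j..node n (j + 1), ‖v x‖ ^ 2
      ≤ ∫ x in node n j..node n (j + 1), (c * ∫ t in node n j..node n (j + 1), ‖d t‖) ^ 2 := by
        refine intervalIntegral.integral_mono_on_of_le_Ioo (node_le_succ j) hvj (by simp)
          fun x hx => ?_
        have := hvd j hj' x hx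
        gcongr
    _ = 1 / n * c ^ 2 * (∫ t in node n j..node n (j + 1), ‖d t‖) ^ 2 := by
        rw [intervalIntegral.integral_const, node_succ_sub, smul_eq_mul]; ring
    _ ≤ 1 / n * c ^ 2 * (1 / n * ∫ x in node n j..node n (j + 1), ‖d x‖ ^ 2) := by gcongr
    _ = _ := by ring

lemma l2Norm_sub_pl_le (hn : 0 < n) (hu : IsPrimitive 0 1 u du) (h : IsPrimitive 0 1 du d2u)
    (hd : IsL2On 0 1 d2u) :
    l2Norm (fun x => u x - pl n (fun i => u (node n i)) x) ≤ (1 / n) ^ 2 * l2Norm d2u := by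
  rw [sq]
  exact l2Norm_le_of_cell_bound hn
    (MemLp.sub (IsL2On.of_continuousOn (hu.continuousOn zero_le_one)) (pl_isL2On hn)) hd
    (by positivity) fun j hj x hx => norm_sub_pl_le hn hu h hj (Ioo_subset_Icc_self hx)

lemma l2Norm_sub_plDeriv_le (hn : 0 < n) (hu : IsPrimitive 0 1 u du) (h : IsPrimitive 0 1 du d2u)
    (hd : IsL2On 0 1 d2u) :
    l2Norm (fun x => du x - plDeriv n (fun i => u (node n i)) x) ≤ 1 / n * l2Norm d2u := by
  rw [← one_mul (1 / (n : ℝ))]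
  refine l2Norm_le_of_cell_bound hn
    (MemLp.sub (IsL2On.of_continuousOn (h.continuousOn zero_le_one)) (plDeriv_isL2On hn)) hd
    (by positivity) fun j hj x hx => ?_
  rw [one_mul, Pi.sub_apply, plDeriv_eq hn (Ioo_subset_Ico_self hx)]
  exact norm_cellSlope_sub_le hn hu h hj (Ioo_subset_Icc_self hx)

/-- Since `du` is continuous, a jump of the interpolant's slope is a difference of two slope errors
at the common node; at the right endpoint the impedance condition plays the role of the missing
neighbour. -/
lemma sum_slopeJump_interpolant_le {k : ℝ} (hn : 0 < n) (hu : IsPrimitive 0 1 u du)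
    (h : IsPrimitive 0 1 du d2u) (hd : IsL2On 0 1 d2u) (hr : du 1 = Complex.I * k * u 1) :
    1 / n * ∑ j ∈ Finset.range n, ‖slopeJump k n (fun i => u (node n i)) j‖ ^ 2 ≤
      (2 * (1 / n) * l2Norm d2u) ^ 2 := by
  have hn' : (0 : ℝ) < n := by exact_mod_cast hn
  set δ : ℕ → ℝ := fun j => ∫ t in node n j..node n (j + 1), ‖d2u t‖
  -- Extended by zero beyond the last cell, so that shifting the index does not increase the sum.
  set m : ℕ → ℝ := fun j => if j < n then δ j ^ 2 else 0
  have hδ0 : ∀ j, 0 ≤ δ j := fun j =>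
    intervalIntegral.integral_nonneg (node_le_succ j) fun _ _ => norm_nonneg _
  have hJ : ∀ j < n, ‖slopeJump k n (fun i => u (node n i)) j‖ ^ 2 ≤ 2 * m j + 2 * m (j + 1) := by
    intro j hj
    have h1 := norm_cellSlope_sub_le hn hu h hj (right_mem_cell j)
    simp only [slopeJump, m, hj, if_true]
    split_ifs with h2
    · have h3 := norm_cellSlope_sub_le hn hu h h2 (left_mem_cell (j + 1))
      have h4 : ‖cellSlope n (fun i => u (node n i)) j -
          cellSlope n (fun i => u (node n i)) (j + 1)‖ ≤ δ j + δ (j + 1) := by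
        refine le_trans (le_of_eq ?_) ((norm_sub_le (du (node n (j + 1)) -
          cellSlope n (fun i => u (node n i)) (j + 1)) (du (node n (j + 1)) -
          cellSlope n (fun i => u (node n i)) j)).trans (by linarith))
        congr 1; ring
      calc _ ≤ (δ j + δ (j + 1)) ^ 2 := by gcongr
        _ ≤ _ := by nlinarith [sq_nonneg (δ j - δ (j + 1))]
    · have h3 : j + 1 = n := by omega
      rw [h3, node_self hn, hr, norm_sub_rev] at h1
      rw [node_self hn]
      have h5 : ∫ t in node n j..1, ‖d2u t‖ = δ j := by
        simp only [δ]; rw [h3, node_self hn]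
      rw [h5] at h1
      have : ‖cellSlope n (fun i => u (node n i)) j - Complex.I * k * u 1‖ ^ 2 ≤ δ j ^ 2 := by
        gcongr
      nlinarith [sq_nonneg (δ j)]
  have hm : ∑ j ∈ Finset.range n, m j ≤ 1 / n * l2Norm d2u ^ 2 := by
    rw [l2Norm_sq, integral_eq_sum_cells hn (hd.intervalIntegrable_sq zero_le_one), Finset.mul_sum]
    refine Finset.sum_le_sum fun j hj => ?_
    have hj' := Finset.mem_range.1 hj
    simp only [m, hj', if_true]
    exact sq_integral_norm_cell_le hd hj'
  have hm' : ∑ j ∈ Finset.range n, m (j + 1) ≤ ∑ j ∈ Finset.range n, m j := by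
    have h1 := Finset.sum_range_succ' m n
    have h2 := Finset.sum_range_succ m n
    have h3 : m n = 0 := by simp [m]
    have h4 : 0 ≤ m 0 := by simp only [m]; split_ifs; positivity
    linarith
  calc _ ≤ 1 / (n : ℝ) * ∑ j ∈ Finset.range n, (2 * m j + 2 * m (j + 1)) := by
        gcongr with j hj
        exact hJ j (Finset.mem_range.1 hj)
    _ = 1 / (n : ℝ) * (2 * ∑ j ∈ Finset.range n, m j + 2 * ∑ j ∈ Finset.range n, m (j + 1)) := by
        rw [Finset.sum_add_distrib, Finset.mul_sum, Finset.mul_sum]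
    _ ≤ 1 / (n : ℝ) * (4 * (1 / n * l2Norm d2u ^ 2)) := by
        gcongr
        linarith
    _ = _ := by ring

end Interpolation

/-! ### The bilinear form in nodal values -/

lemma integral_normSq_affine (a b : ℂ) {α h : ℝ} (hh : 0 < h) :
    ∫ x in α..(α + h), ‖a + (((x - α) / h : ℝ) : ℂ) * (b - a)‖ ^ 2 =
      h / 3 * (‖a‖ ^ 2 + ‖b‖ ^ 2 + (a * conj b).re) := by
  have h1 : ∀ x : ℝ, ‖a + (((x - α) / h : ℝ) : ℂ) * (b - a)‖ ^ 2 =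
      (a.re + (x - α) / h * (b.re - a.re)) ^ 2 + (a.im + (x - α) / h * (b.im - a.im)) ^ 2 :=
    fun x => by
      rw [← Complex.normSq_eq_norm_sq, Complex.normSq_apply, Complex.add_re, Complex.add_im,
        Complex.re_ofReal_mul, Complex.im_ofReal_mul, Complex.sub_re, Complex.sub_im]
      ring
  have hd : ∀ x : ℝ, HasDerivAt (fun x : ℝ =>
      h * ((a.re ^ 2 + a.im ^ 2) * ((x - α) / h)
        + (a.re * (b.re - a.re) + a.im * (b.im - a.im)) * ((x - α) / h) ^ 2
        + ((b.re - a.re) ^ 2 + (b.im - a.im) ^ 2) / 3 * ((x - α) / h) ^ 3))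
      ((a.re + (x - α) / h * (b.re - a.re)) ^ 2 + (a.im + (x - α) / h * (b.im - a.im)) ^ 2) x := by
    intro x
    have hs : HasDerivAt (fun x : ℝ => (x - α) / h) (1 / h) x :=
      ((hasDerivAt_id x).sub_const α).div_const h
    refine ((((hs.const_mul _).add ((hs.pow 2).const_mul _)).add
      ((hs.pow 3).const_mul _)).const_mul h).congr_deriv ?_
    generalize (x - α) / h = y
    field_simp
    push_cast
    ring
  simp only [h1]
  rw [intervalIntegral.integral_eq_sub_of_hasDerivAt (fun x _ => hd x)
    (Continuous.intervalIntegrable (by fun_prop) _ _)]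
  rw [← Complex.normSq_eq_norm_sq, ← Complex.normSq_eq_norm_sq, Complex.normSq_apply,
    Complex.normSq_apply, Complex.mul_re, Complex.conj_re, Complex.conj_im]
  rw [add_sub_cancel_left, sub_self, div_self hh.ne']
  ring

/-- On a cell the squared norm is h/3 (|a|² + |b|² + Re a b̄), and this bracket is at least |b|²/2;
hence the factor 6. -/
lemma sum_nodal_le (hn : 0 < n) :
    1 / n * ∑ j ∈ Finset.range n, ‖U (j + 1)‖ ^ 2 ≤ 6 * l2Norm (pl n U) ^ 2 := by
  have hn' : (0 : ℝ) < n := by exact_mod_cast hn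
  rw [l2Norm_sq, integral_eq_sum_cells hn ((pl_isL2On hn).intervalIntegrable_sq zero_le_one),
    Finset.mul_sum, Finset.mul_sum]
  refine Finset.sum_le_sum fun j hj => ?_
  have h1 : ∫ x in node n j..node n (j + 1), ‖pl n U x‖ ^ 2 =
      (1 / n : ℝ) / 3 * (‖U j‖ ^ 2 + ‖U (j + 1)‖ ^ 2 + (U j * conj (U (j + 1))).re) := by
    rw [← integral_normSq_affine (U j) (U (j + 1)) (α := node n j) (h := 1 / n) (by positivity),
      ← node_succ_sub j, add_sub_cancel]
    refine integral_congr_cell fun x hx => ?_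
    rw [pl_eq hn (Ioo_subset_Icc_self hx), node_succ_sub]
    have : (n : ℂ) * node n j = j := by exact_mod_cast mul_node hn j
    rw [← this]
    congr 3
    push_cast
    field_simp
  rw [h1]
  have h2 : |(U j * conj (U (j + 1))).re| ≤ ‖U j‖ * ‖U (j + 1)‖ := by
    refine (Complex.abs_re_le_norm _).trans ?_
    rw [norm_mul, Complex.norm_conj]
  have h3 := (abs_le.1 h2).1
  have h4 : ‖U (j + 1)‖ ^ 2 ≤
      2 * (‖U j‖ ^ 2 + ‖U (j + 1)‖ ^ 2 + (U j * conj (U (j + 1))).re) := by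
    nlinarith [sq_nonneg (‖U j‖ - ‖U (j + 1)‖), sq_nonneg (‖U j‖)]
  calc 1 / (n : ℝ) * ‖U (j + 1)‖ ^ 2 ≤ 1 / (n : ℝ) *
        (2 * (‖U j‖ ^ 2 + ‖U (j + 1)‖ ^ 2 + (U j * conj (U (j + 1))).re)) := by gcongr
    _ = _ := by ring

variable {k M : ℝ} {γ : ℂ}

/-- The bilinear penalty form (without the factor `γ`). -/
noncomputable def jumpForm (k : ℝ) (n : ℕ) (U V : ℕ → ℂ) : ℂ :=
  1 / (n : ℂ) * ∑ j ∈ Finset.range n, slopeJump k n U j * slopeJump k n V j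

/-- The squared seminorm of the slope jumps. -/
noncomputable def jumpSq (k : ℝ) (n : ℕ) (U : ℕ → ℂ) : ℝ :=
  1 / (n : ℝ) * ∑ j ∈ Finset.range n, ‖slopeJump k n U j‖ ^ 2

/-- The squared `L²` norm of the derivative of `pl n U`. -/
noncomputable def slopeSq (n : ℕ) (U : ℕ → ℂ) : ℝ :=
  1 / (n : ℝ) * ∑ j ∈ Finset.range n, ‖cellSlope n U j‖ ^ 2

/-- The bilinear version of `cipForm` in terms of nodal values. -/
noncomputable def cipBilin (k : ℝ) (γ : ℂ) (n : ℕ) (U V : ℕ → ℂ) : ℂ :=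
  1 / (n : ℂ) * ∑ j ∈ Finset.range n, cellSlope n U j * cellSlope n V j
    - k ^ 2 * (∫ x in (0 : ℝ)..1, pl n U x * pl n V x) - Complex.I * k * U n * V n
    + γ * jumpForm k n U V

lemma jumpSq_nonneg : 0 ≤ jumpSq k n U := by unfold jumpSq; positivity

lemma slopeSq_nonneg : 0 ≤ slopeSq n U := by unfold slopeSq; positivity

lemma slopeSq_eq (hn : 0 < n) : slopeSq n U = l2Norm (plDeriv n U) ^ 2 := by
  rw [l2Norm_sq, integral_eq_sum_cells hn
    ((plDeriv_isL2On hn).intervalIntegrable_sq zero_le_one), slopeSq, Finset.mul_sum]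
  refine Finset.sum_congr rfl fun j _ => ?_
  rw [integral_congr_cell (G := fun _ => ‖cellSlope n U j‖ ^ 2) fun x hx => by
    rw [plDeriv_eq hn (Ioo_subset_Ico_self hx)], intervalIntegral.integral_const, node_succ_sub,
    smul_eq_mul]

/-- Conjugation flips the sign of ik in the impedance residual. Hence both signs of `k` occur in the
estimates of the penalty form. -/
lemma slopeJump_conj (j : ℕ) :
    slopeJump k n (fun i => conj (U i)) j = conj (slopeJump (-k) n U j) := by
  simp only [slopeJump, cellSlope_conj]
  split_ifs <;> simp [sub_eq_add_neg]

lemma jumpSq_conj : jumpSq k n (fun i => conj (U i)) = jumpSq (-k) n U := by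
  simp [jumpSq, slopeJump_conj]

lemma norm_jumpForm_sq_le : ‖jumpForm k n U V‖ ^ 2 ≤ jumpSq k n U * jumpSq k n V := by
  have h1 : ‖∑ j ∈ Finset.range n, slopeJump k n U j * slopeJump k n V j‖ ^ 2 ≤
      (∑ j ∈ Finset.range n, ‖slopeJump k n U j‖ ^ 2) *
        ∑ j ∈ Finset.range n, ‖slopeJump k n V j‖ ^ 2 := by
    refine le_trans ?_ (Finset.sum_mul_sq_le_sq_mul_sq _ _ _)
    gcongr
    refine (norm_sum_le _ _).trans (le_of_eq ?_)
    simp only [norm_mul]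
  simp only [jumpForm, jumpSq, norm_mul, norm_div, norm_one, Complex.norm_natCast]
  calc _ = (1 / (n : ℝ)) ^ 2 *
        ‖∑ j ∈ Finset.range n, slopeJump k n U j * slopeJump k n V j‖ ^ 2 := by ring
    _ ≤ (1 / (n : ℝ)) ^ 2 * ((∑ j ∈ Finset.range n, ‖slopeJump k n U j‖ ^ 2) *
        ∑ j ∈ Finset.range n, ‖slopeJump k n V j‖ ^ 2) := by gcongr
    _ = _ := by ring

lemma norm_jumpForm_le {a b : ℝ} (hb : 0 ≤ b) (ha : 0 ≤ a) (hU : jumpSq k n U ≤ a ^ 2)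
    (hV : jumpSq k n V ≤ b ^ 2) : ‖jumpForm k n U V‖ ≤ a * b := by
  refine abs_le_of_sq_le_sq' ?_ (by positivity) |>.2
  rw [mul_pow]
  exact norm_jumpForm_sq_le.trans (mul_le_mul hU hV jumpSq_nonneg (by positivity))

lemma integrable_pl_mul (hn : 0 < n) :
    IntervalIntegrable (fun x => pl n U x * pl n V x) volume 0 1 := by
  refine ContinuousOn.intervalIntegrable ?_
  rw [uIcc_of_le zero_le_one]
  exact (pl_continuousOn hn).mul (pl_continuousOn hn)

lemma slopeJump_add_const_mul (c : ℂ) (j : ℕ) : slopeJump k n (fun i => U i + c * V i) j =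
    slopeJump k n U j + c * slopeJump k n V j := by
  simp only [slopeJump, cellSlope]
  split_ifs <;> ring

/-- This symmetry makes the dual problem coincide with the original one. -/
lemma cipBilin_comm : cipBilin k γ n U V = cipBilin k γ n V U := by
  simp only [cipBilin, jumpForm, mul_comm (cellSlope n U _), mul_comm (pl n U _),
    mul_comm (slopeJump k n U _)]
  ring

lemma cipBilin_add_const_mul (hn : 0 < n) {W : ℕ → ℂ} (c : ℂ) :
    cipBilin k γ n (fun i => U i + c * V i) W = cipBilin k γ n U W + c * cipBilin k γ n V W := by
  have h1 : ∫ x in (0 : ℝ)..1, pl n (fun i => U i + c * V i) x * pl n W x =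
      (∫ x in (0 : ℝ)..1, pl n U x * pl n W x) + c * ∫ x in (0 : ℝ)..1, pl n V x * pl n W x := by
    rw [← intervalIntegral.integral_const_mul, ← intervalIntegral.integral_add
      (integrable_pl_mul hn) ((integrable_pl_mul hn).const_mul _)]
    congr 1; ext x
    simp only [pl]; ring
  have h2 : ∑ j ∈ Finset.range n, cellSlope n (fun i => U i + c * V i) j * cellSlope n W j =
      ∑ j ∈ Finset.range n, cellSlope n U j * cellSlope n W j +
        c * ∑ j ∈ Finset.range n, cellSlope n V j * cellSlope n W j := by
    rw [Finset.mul_sum, ← Finset.sum_add_distrib]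
    refine Finset.sum_congr rfl fun j _ => ?_
    simp only [cellSlope]; ring
  have h3 : jumpForm k n (fun i => U i + c * V i) W =
      jumpForm k n U W + c * jumpForm k n V W := by
    simp only [jumpForm, slopeJump_add_const_mul, add_mul, Finset.sum_add_distrib, mul_assoc c,
      ← Finset.mul_sum]
    ring
  rw [cipBilin, h1, h2, h3, cipBilin, cipBilin]
  ring

/-- Only the last entry, at the right endpoint, depends on `k`. -/
lemma jumpSq_le (hn : 0 < n) : jumpSq k n U ≤ 2 * jumpSq 0 n U + 2 * (1 / n) * k ^ 2 * ‖U n‖ ^ 2 := by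
  obtain ⟨m, rfl⟩ := Nat.exists_eq_succ_of_ne_zero hn.ne'
  have h1 : ∀ j, ‖slopeJump k (m + 1) U j‖ ^ 2 ≤ 2 * ‖slopeJump 0 (m + 1) U j‖ ^ 2 +
      if j = m then 2 * k ^ 2 * ‖U (m + 1)‖ ^ 2
      else 2 * ‖slopeJump k (m + 1) U j‖ ^ 2 := by
    intro j
    split_ifs with h
    · simp only [slopeJump, h, lt_irrefl, if_false, Complex.ofReal_zero, mul_zero, zero_mul,
        sub_zero]
      have h2 := norm_sub_le (cellSlope (m + 1) U m) (Complex.I * k * U (m + 1))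
      have h3 : ‖Complex.I * k * U (m + 1)‖ ^ 2 = k ^ 2 * ‖U (m + 1)‖ ^ 2 := by
        simp [mul_pow]
      have h4 : ‖cellSlope (m + 1) U m - Complex.I * k * U (m + 1)‖ ^ 2 ≤
        (‖cellSlope (m + 1) U m‖ + ‖Complex.I * k * U (m + 1)‖) ^ 2 := by gcongr
      nlinarith [sq_nonneg (‖cellSlope (m + 1) U m‖ - ‖Complex.I * k * U (m + 1)‖)]
    · nlinarith [sq_nonneg ‖slopeJump k (m + 1) U j‖, sq_nonneg ‖slopeJump 0 (m + 1) U j‖]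
  have h2 : ∀ j < m, slopeJump k (m + 1) U j = slopeJump 0 (m + 1) U j := fun j hj => by
    simp [slopeJump, hj]
  have h3 := h1 m
  simp only [if_true] at h3
  have h4 : ∑ j ∈ Finset.range (m + 1), ‖slopeJump k (m + 1) U j‖ ^ 2 ≤
      2 * ∑ j ∈ Finset.range (m + 1), ‖slopeJump 0 (m + 1) U j‖ ^ 2 +
        2 * k ^ 2 * ‖U (m + 1)‖ ^ 2 := by
    rw [Finset.sum_range_succ, Finset.sum_range_succ, Finset.sum_congr rfl fun j hj => by
      rw [h2 j (Finset.mem_range.1 hj)]]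
    have : 0 ≤ ∑ j ∈ Finset.range m, ‖slopeJump 0 (m + 1) U j‖ ^ 2 := by positivity
    linarith
  simp only [jumpSq]
  have h5 : 0 ≤ 1 / ((m + 1 : ℕ) : ℝ) := by positivity
  have h6 := mul_le_mul_of_nonneg_left h4 h5
  simp only [Nat.succ_eq_add_one]
  linarith

lemma mul_conj_eq_norm_sq (z : ℂ) : z * conj z = ((‖z‖ ^ 2 : ℝ) : ℂ) := by
  rw [Complex.mul_conj, Complex.normSq_eq_norm_sq]

lemma integral_pl_mul_conj :
    ∫ x in (0 : ℝ)..1, pl n U x * pl n (fun i => conj (U i)) x =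
      ((l2Norm (pl n U) ^ 2 : ℝ) : ℂ) := by
  simp only [pl_conj, mul_conj_eq_norm_sq]
  rw [l2Norm_sq]
  exact intervalIntegral.integral_ofReal

lemma cipBilin_conj_self : cipBilin k γ n U (fun i => conj (U i)) =
    ((slopeSq n U - k ^ 2 * l2Norm (pl n U) ^ 2 : ℝ) : ℂ) - Complex.I * ((k * ‖U n‖ ^ 2 : ℝ) : ℂ)
      + γ * jumpForm k n U (fun i => conj (U i)) := by
  simp only [cipBilin, integral_pl_mul_conj, cellSlope_conj, mul_conj_eq_norm_sq, slopeSq,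
    mul_assoc (Complex.I * _)]
  push_cast
  ring

/-- With s the last slope and v the last value, the endpoint term is (s - ikv)(s̄ - ikv̄) = |s|² -
k²|v|² - 2ik Re(s v̄). The second factor is not the conjugate of the first, so the penalty is not a
nonnegative form. -/
lemma jumpForm_conj_self (hn : 0 < n) : jumpForm k n U (fun i => conj (U i)) =
    ((jumpSq 0 n U - 1 / n * k ^ 2 * ‖U n‖ ^ 2 : ℝ) : ℂ) - Complex.I *
      ((2 * k * (1 / n) * (cellSlope n U (n - 1) * conj (U n)).re : ℝ) : ℂ) := by
  obtain ⟨m, rfl⟩ := Nat.exists_eq_succ_of_ne_zero hn.ne'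
  have h2 : ∀ l : ℝ, ∀ j < m, slopeJump l (m + 1) U j = slopeJump 0 (m + 1) U j := fun l j hj => by
    simp [slopeJump, hj]
  have h3 : slopeJump k (m + 1) U m * conj (slopeJump (-k) (m + 1) U m) =
      ((‖slopeJump 0 (m + 1) U m‖ ^ 2 - k ^ 2 * ‖U (m + 1)‖ ^ 2 : ℝ) : ℂ) - Complex.I *
      ((2 * k * (cellSlope (m + 1) U m * conj (U (m + 1))).re : ℝ) : ℂ) := by
    simp only [slopeJump, lt_irrefl, if_false]
    generalize cellSlope (m + 1) U m = s
    generalize U (m + 1) = v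
    have h4 : ((2 * (s * conj v).re : ℝ) : ℂ) = s * conj v + conj s * v := by
      rw [← Complex.add_conj]; simp
    rw [show 2 * k * (s * conj v).re = k * (2 * (s * conj v).re) by ring, Complex.ofReal_mul, h4,
      Complex.ofReal_sub, Complex.ofReal_mul, ← mul_conj_eq_norm_sq, ← mul_conj_eq_norm_sq]
    simp only [Complex.ofReal_zero, Complex.ofReal_neg, mul_zero, zero_mul, sub_zero, map_sub,
      map_mul, map_neg, Complex.conj_I, Complex.conj_ofReal, Complex.ofReal_pow]
    linear_combination (k : ℂ) ^ 2 * v * conj v * Complex.I_sq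
  simp only [jumpForm, jumpSq, slopeJump_conj, Nat.succ_eq_add_one, add_tsub_cancel_right]
  rw [Finset.sum_range_succ, Finset.sum_range_succ, h3, Finset.sum_congr rfl fun j hj => by
    rw [h2 k j (Finset.mem_range.1 hj), h2 (-k) j (Finset.mem_range.1 hj), mul_conj_eq_norm_sq]]
  push_cast
  ring

/-! ### Dissipation and discrete stability -/

/-- The quantity controlled by the imaginary part of the form. -/
noncomputable def dissipation (k : ℝ) (γ : ℂ) (n : ℕ) (U : ℕ → ℂ) : ℝ :=
  |γ.im| / 2 * jumpSq 0 n U + k / 2 * ‖U n‖ ^ 2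

lemma dissipation_nonneg (hk : 0 ≤ k) : 0 ≤ dissipation k γ n U := by
  have := jumpSq_nonneg (k := 0) (n := n) (U := U)
  unfold dissipation; positivity

/-- The indefinite endpoint terms are absorbed by half of the jump term and half of the impedance
term. Young's inequality for the cross term costs 2M²k²h|v|² and the term k²h|v|² costs one more, so
|Im γ|kh(1 + 2M²) ≤ 1/2 is what is needed. -/
lemma dissipation_le (hn : 0 < n) (hk : 0 ≤ k) (hγ : γ.im < 0) (hM : ‖γ‖ ≤ M * |γ.im|)
    (hc : ‖γ‖ * (k * (1 / n)) ≤ 1 / (2 * (1 + 2 * M ^ 2))) :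
    dissipation k γ n U ≤ -(cipBilin k γ n U (fun i => conj (U i))).im := by
  have hn' : (0 : ℝ) < n := by exact_mod_cast hn
  -- With parameter 0 the last jump is the last slope itself.
  have hlast : 1 / (n : ℝ) * ‖cellSlope n U (n - 1)‖ ^ 2 ≤ jumpSq 0 n U := by
    unfold jumpSq
    gcongr
    have := Finset.single_le_sum (f := fun j => ‖slopeJump 0 n U j‖ ^ 2)
      (fun _ _ => by positivity) (Finset.mem_range.2 (Nat.sub_lt hn one_pos))
    refine le_trans (le_of_eq ?_) this
    have h1 : ¬ (n - 1 + 1 < n) := by omega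
    simp [slopeJump, h1]
  rw [cipBilin_conj_self, jumpForm_conj_self hn, dissipation]
  set s := cellSlope n U (n - 1)
  set S := jumpSq 0 n U
  set v := U n
  set h := 1 / (n : ℝ)
  have hh : 0 < h := by positivity
  have hre : |(s * conj v).re| ≤ ‖s‖ * ‖v‖ := by
    refine (Complex.abs_re_le_norm _).trans ?_
    rw [norm_mul, Complex.norm_conj]
  generalize (s * conj v).re = r at hre ⊢
  simp only [Complex.add_im, Complex.sub_im, Complex.mul_im, Complex.sub_re,
    Complex.mul_re, Complex.I_re, Complex.I_im, Complex.ofReal_im, Complex.ofReal_re]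
  have hg : |γ.im| = -γ.im := abs_of_neg hγ
  have hgn : |γ.im| ≤ ‖γ‖ := Complex.abs_im_le_norm γ
  have hgr : |γ.re| ≤ M * |γ.im| := (Complex.abs_re_le_norm γ).trans hM
  have hg0 : 0 ≤ |γ.im| := abs_nonneg _
  have h1 : |γ.re * r| ≤ M * |γ.im| * (‖s‖ * ‖v‖) := by
    rw [abs_mul]
    exact mul_le_mul hgr hre (abs_nonneg _) ((abs_nonneg _).trans hgr)
  have h2 : |γ.im| * k * h * (1 + 2 * M ^ 2) ≤ 1 / 2 := by
    have h5 : |γ.im| * (k * h) ≤ 1 / (2 * (1 + 2 * M ^ 2)) :=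
      le_trans (by gcongr) hc
    rw [le_div_iff₀ (by positivity)] at h5
    linarith
  have h3 : |γ.im| * h * (2 * (M * k * (‖s‖ * ‖v‖))) ≤
      |γ.im| * h * (1 / 2 * ‖s‖ ^ 2 + 2 * M ^ 2 * k ^ 2 * ‖v‖ ^ 2) := by
    gcongr
    nlinarith [sq_nonneg (‖s‖ - 2 * M * k * ‖v‖)]
  have h4 : |γ.im| * k * h * (1 + 2 * M ^ 2) * (k * ‖v‖ ^ 2) ≤ 1 / 2 * (k * ‖v‖ ^ 2) := by
    gcongr
  have h6 : -(M * |γ.im| * (‖s‖ * ‖v‖)) ≤ γ.re * r := (abs_le.1 h1).1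
  have h7 : 2 * k * h * -(M * |γ.im| * (‖s‖ * ‖v‖)) ≤ 2 * k * h * (γ.re * r) := by gcongr
  have h8 : |γ.im| * (h * ‖s‖ ^ 2) ≤ |γ.im| * S := by gcongr
  rw [hg] at *
  linarith

lemma norm_mul_jumpSq_le (hn : 0 < n) (hk : 0 ≤ k) (hM1 : 1 ≤ M) (hM : ‖γ‖ ≤ M * |γ.im|)
    (hc : ‖γ‖ * (k * (1 / n)) ≤ 1 / (2 * (1 + 2 * M ^ 2))) {l : ℝ} (hl : l ^ 2 = k ^ 2) :
    ‖γ‖ * jumpSq l n U ≤ 4 * M * dissipation k γ n U := by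
  have h0 := jumpSq_nonneg (k := 0) (n := n) (U := U)
  have h1 := jumpSq_le (k := l) (U := U) hn
  have h2 : ‖γ‖ * (k * (1 / n)) ≤ 1 := hc.trans (by
    rw [div_le_one (by positivity)]; nlinarith)
  rw [hl] at h1
  have h3 : ‖γ‖ * jumpSq 0 n U ≤ M * |γ.im| * jumpSq 0 n U := by gcongr
  have h4 : ‖γ‖ * (k * (1 / n)) * (k * ‖U n‖ ^ 2) ≤ M * (k * ‖U n‖ ^ 2) := by
    gcongr; linarith
  calc ‖γ‖ * jumpSq l n U ≤ ‖γ‖ * (2 * jumpSq 0 n U + 2 * (1 / n) * k ^ 2 * ‖U n‖ ^ 2) := by gcongr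
    _ = 2 * (‖γ‖ * jumpSq 0 n U) + 2 * (‖γ‖ * (k * (1 / n)) * (k * ‖U n‖ ^ 2)) := by ring
    _ ≤ 2 * (M * |γ.im| * jumpSq 0 n U) + 2 * (M * (k * ‖U n‖ ^ 2)) := by gcongr
    _ = _ := by rw [dissipation]; ring

lemma norm_mul_jumpForm_conj_le (hn : 0 < n) (hk : 0 ≤ k) (hM1 : 1 ≤ M) (hM : ‖γ‖ ≤ M * |γ.im|)
    (hc : ‖γ‖ * (k * (1 / n)) ≤ 1 / (2 * (1 + 2 * M ^ 2))) :
    ‖γ * jumpForm k n U (fun i => conj (U i))‖ ≤ 4 * M * dissipation k γ n U := by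
  have hd := dissipation_nonneg (γ := γ) (n := n) (U := U) hk
  have h1 := norm_mul_jumpSq_le (U := U) hn hk hM1 hM hc (l := k) rfl
  have h2 := norm_mul_jumpSq_le (U := U) hn hk hM1 hM hc (l := -k) (by ring)
  refine abs_le_of_sq_le_sq' ?_ (by positivity) |>.2
  rw [norm_mul, mul_pow]
  have h3 := norm_jumpForm_sq_le (k := k) (n := n) (U := U) (V := fun i => conj (U i))
  rw [jumpSq_conj] at h3
  calc _ ≤ ‖γ‖ ^ 2 * (jumpSq k n U * jumpSq (-k) n U) := by gcongr
    _ = (‖γ‖ * jumpSq k n U) * (‖γ‖ * jumpSq (-k) n U) := by ring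
    _ ≤ (4 * M * dissipation k γ n U) * (4 * M * dissipation k γ n U) :=
        mul_le_mul h1 h2 (mul_nonneg (norm_nonneg _) jumpSq_nonneg) (by positivity)
    _ = _ := by ring

/-- The Gårding identity: the derivative is controlled by the form and the lower order terms. -/
lemma abs_slopeSq_sub_le (hn : 0 < n) (hk : 0 ≤ k) (hM1 : 1 ≤ M) (hM : ‖γ‖ ≤ M * |γ.im|)
    (hc : ‖γ‖ * (k * (1 / n)) ≤ 1 / (2 * (1 + 2 * M ^ 2))) :
    |slopeSq n U - k ^ 2 * l2Norm (pl n U) ^ 2| ≤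
      ‖cipBilin k γ n U (fun i => conj (U i))‖ + 4 * M * dissipation k γ n U := by
  have h1 := norm_mul_jumpForm_conj_le (U := U) hn hk hM1 hM hc
  have h2 := cipBilin_conj_self (k := k) (γ := γ) (n := n) (U := U)
  have h3 : slopeSq n U - k ^ 2 * l2Norm (pl n U) ^ 2 =
      (cipBilin k γ n U (fun i => conj (U i)) - γ * jumpForm k n U (fun i => conj (U i))).re := by
    rw [h2]
    simp only [Complex.add_re, Complex.sub_re, Complex.ofReal_re, Complex.mul_re, Complex.I_re,
      Complex.I_im, Complex.ofReal_im]
    ring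
  rw [h3]
  exact (Complex.abs_re_le_norm _).trans ((norm_sub_le _ _).trans (by gcongr))

/-- Summation by parts writes the Dirichlet energy as the sum of slope jumps times conjugate nodal
values: the term at 0 vanishes, and at the right endpoint the jump with parameter 0 is the last
slope. Cauchy–Schwarz and `sum_nodal_le` finish. -/
lemma slopeSq_sq_le (hn : 0 < n) (hU : U 0 = 0) :
    slopeSq n U ^ 2 ≤ 6 * (n : ℝ) ^ 2 * jumpSq 0 n U * l2Norm (pl n U) ^ 2 := by
  have hn' : (0 : ℝ) < n := by exact_mod_cast hn
  have hnc : (n : ℂ) ≠ 0 := by exact_mod_cast hn.ne'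
  have h1 : ((slopeSq n U : ℝ) : ℂ) =
      ∑ j ∈ Finset.range n, slopeJump 0 n U j * conj (U (j + 1)) := by
    have h2 : ((slopeSq n U : ℝ) : ℂ) =
        ∑ j ∈ Finset.range n, cellSlope n U j * (conj (U (j + 1)) - conj (U j)) := by
      simp only [slopeSq]
      push_cast
      rw [Finset.mul_sum]
      refine Finset.sum_congr rfl fun j _ => ?_
      have : conj (U (j + 1)) - conj (U j) = 1 / (n : ℂ) * conj (cellSlope n U j) := by
        simp only [cellSlope, map_mul, map_sub, Complex.conj_natCast]
        field_simp
      have h5 := mul_conj_eq_norm_sq (cellSlope n U j)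
      push_cast at h5
      rw [this, ← h5]
      ring
    rw [h2]
    obtain ⟨m, rfl⟩ := Nat.exists_eq_succ_of_ne_zero hn.ne'
    simp only [mul_sub, Finset.sum_sub_distrib]
    rw [Finset.sum_range_succ' (fun j => cellSlope (m + 1) U j * conj (U j)),
      Finset.sum_range_succ, Finset.sum_range_succ, hU, map_zero, mul_zero, add_zero,
      add_sub_right_comm, ← Finset.sum_sub_distrib]
    congr 1
    · refine Finset.sum_congr rfl fun j hj => ?_
      have := Finset.mem_range.1 hj
      simp only [slopeJump, Nat.succ_eq_add_one, add_lt_add_iff_right, this, if_true]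
      ring
    · simp [slopeJump]
  have h2 : slopeSq n U ^ 2 ≤ (∑ j ∈ Finset.range n, ‖slopeJump 0 n U j‖ ^ 2) *
      ∑ j ∈ Finset.range n, ‖U (j + 1)‖ ^ 2 := by
    refine le_trans ?_ (Finset.sum_mul_sq_le_sq_mul_sq _ _ _)
    have h3 : slopeSq n U = ‖((slopeSq n U : ℝ) : ℂ)‖ := by
      rw [Complex.norm_real, Real.norm_of_nonneg slopeSq_nonneg]
    rw [h3, h1]
    gcongr
    refine (norm_sum_le _ _).trans (le_of_eq ?_)
    simp only [norm_mul, Complex.norm_conj]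
  have h3 := sum_nodal_le (U := U) hn
  have h4 : ∑ j ∈ Finset.range n, ‖slopeJump 0 n U j‖ ^ 2 = n * jumpSq 0 n U := by
    rw [jumpSq]; field_simp
  have h5 : ∑ j ∈ Finset.range n, ‖U (j + 1)‖ ^ 2 ≤ n * (6 * l2Norm (pl n U) ^ 2) := by
    calc _ = n * (1 / (n : ℝ) * ∑ j ∈ Finset.range n, ‖U (j + 1)‖ ^ 2) := by field_simp
      _ ≤ _ := by gcongr
  rw [h4] at h2
  have := jumpSq_nonneg (k := 0) (n := n) (U := U)
  calc _ ≤ _ := h2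
    _ ≤ n * jumpSq 0 n U * (n * (6 * l2Norm (pl n U) ^ 2)) := by gcongr
    _ = _ := by ring

/-- Stability of the discrete problem by dissipation only. -/
lemma cip_stability (hn : 0 < n) (hk : 1 ≤ k) (hM1 : 1 ≤ M) (hγ : γ.im < 0)
    (hM : ‖γ‖ ≤ M * |γ.im|) (hc : ‖γ‖ * (k * (1 / n)) ≤ 1 / (2 * (1 + 2 * M ^ 2)))
    (hU : U 0 = 0) {F : ℝ} (hF : 0 ≤ F)
    (hB : ‖cipBilin k γ n U (fun i => conj (U i))‖ ≤ F * l2Norm (pl n U)) :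
    k * l2Norm (pl n U) ≤ 10 * M * F + 12 * F / (|γ.im| * (k ^ 3 * (1 / n) ^ 2)) ∧
      slopeSq n U ≤ (k * l2Norm (pl n U) + 5 * M * F) ^ 2 := by
  have hn' : (0 : ℝ) < n := by exact_mod_cast hn
  have hk0 : 0 ≤ k := by linarith
  have hg : 0 < |γ.im| := abs_pos.2 hγ.ne
  have hQ : dissipation k γ n U ≤ F * l2Norm (pl n U) :=
    (dissipation_le hn hk0 hγ hM hc).trans ((neg_le_abs _).trans
      ((Complex.abs_im_le_norm _).trans hB))
  have hG := abs_slopeSq_sub_le (U := U) hn hk0 hM1 hM hc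
  have hD := slopeSq_sq_le hn hU
  have hN := l2Norm_nonneg (pl n U)
  have hS := jumpSq_nonneg (k := 0) (n := n) (U := U)
  have hS2 : |γ.im| * jumpSq 0 n U ≤ 2 * F * l2Norm (pl n U) := by
    have : 0 ≤ k / 2 * ‖U n‖ ^ 2 := by positivity
    unfold dissipation at hQ
    linarith
  set N := l2Norm (pl n U)
  set D := slopeSq n U
  set S := jumpSq 0 n U
  have hFN : 0 ≤ F * N := by positivity
  -- The constant is 1 + 4M ≤ 5M.
  have hG' : |D - k ^ 2 * N ^ 2| ≤ 5 * M * (F * N) := by nlinarith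
  have hG1 := (abs_le.1 hG').1
  have hG2 := (abs_le.1 hG').2
  refine ⟨?_, ?_⟩
  · set b := 12 * F / (|γ.im| * (k ^ 3 * (1 / n) ^ 2)) with hb
    have hb0 : 0 ≤ b := by positivity
    have hbe : b * (|γ.im| * k ^ 3) = 12 * F * n ^ 2 := by
      rw [hb]; field_simp
    -- D² is at most (k²N²)(kbN), so D is at most the arithmetic mean of the factors; half of k²N²
    -- can then be absorbed in the Gårding bound.
    have hDE : D ≤ 1 / 2 * k ^ 2 * N ^ 2 + 1 / 2 * k * b * N := by
      refine abs_le_of_sq_le_sq' ?_ (by positivity) |>.2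
      have h1 : |γ.im| * D ^ 2 ≤ |γ.im| * (k ^ 3 * b * N ^ 3) := by
        calc |γ.im| * D ^ 2 ≤ |γ.im| * (6 * n ^ 2 * S * N ^ 2) := by gcongr
          _ = 6 * n ^ 2 * N ^ 2 * (|γ.im| * S) := by ring
          _ ≤ 6 * n ^ 2 * N ^ 2 * (2 * F * N) := by gcongr
          _ = (12 * F * n ^ 2) * N ^ 3 := by ring
          _ = _ := by rw [← hbe]; ring
      have h2 := le_of_mul_le_mul_left h1 hg
      nlinarith [sq_nonneg (1 / 2 * k ^ 2 * N ^ 2 - 1 / 2 * k * b * N)]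
    have h3 : k ^ 2 * N ^ 2 ≤ 10 * M * (F * N) + k * b * N := by linarith
    rcases hN.eq_or_lt with h0 | h0
    · rw [← h0, mul_zero]; positivity
    · have h4 : k * N * (k * N) ≤ (10 * M * F + b) * (k * N) := by
        have : 10 * M * (F * N) ≤ 10 * M * (F * (k * N)) := by
          gcongr; exact le_mul_of_one_le_left hN hk
        linarith
      exact le_of_mul_le_mul_right h4 (by positivity)
  · have h5 : 5 * M * (F * N) ≤ 5 * M * (F * (k * N)) := by
      gcongr; exact le_mul_of_one_le_left hN hk
    have h6 : 0 ≤ M * F * (k * N) := by positivity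
    nlinarith [sq_nonneg (5 * M * F)]

/-- Uniqueness for the discrete problem. -/
lemma eq_zero_of_cipBilin_conj_self (hn : 0 < n) (hk : 1 ≤ k) (hM1 : 1 ≤ M) (hγ : γ.im < 0)
    (hM : ‖γ‖ ≤ M * |γ.im|) (hc : ‖γ‖ * (k * (1 / n)) ≤ 1 / (2 * (1 + 2 * M ^ 2)))
    (hU : U 0 = 0) (hB : cipBilin k γ n U (fun i => conj (U i)) = 0) {j : ℕ} (hj : j ≤ n) :
    U j = 0 := by
  have hn' : (0 : ℝ) < n := by exact_mod_cast hn
  have h1 := (cip_stability hn hk hM1 hγ hM hc hU le_rfl (by rw [hB]; simp)).1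
  have h2 := l2Norm_nonneg (pl n U)
  have h3 : l2Norm (pl n U) = 0 := by
    simp only [mul_zero, zero_div, add_zero] at h1
    nlinarith
  have h4 := sum_nodal_le (U := U) hn
  rw [h3] at h4
  rcases j with _ | j
  · exact hU
  · have h5 : ∑ i ∈ Finset.range n, ‖U (i + 1)‖ ^ 2 ≤ 0 := by
      have : 0 < 1 / (n : ℝ) := by positivity
      by_contra! h
      have := mul_pos this h
      linarith
    have h6 := Finset.single_le_sum (f := fun i => ‖U (i + 1)‖ ^ 2) (fun _ _ => by positivity)
      (Finset.mem_range.2 (Nat.lt_of_succ_le hj))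
    have h7 : ‖U (j + 1)‖ ^ 2 = 0 := le_antisymm (h6.trans h5) (by positivity)
    simpa using h7

/-! ### Error of the discrete solution against the interpolant -/

section Error

variable {f u du d2u : ℝ → ℂ}

/-- The form applied to the interpolant of an exact solution. -/
lemma cipBilin_interpolant (hn : 0 < n) (h : HelmholtzData k f u du d2u) (hV : V 0 = 0) :
    cipBilin k γ n (fun i => u (node n i)) V = (∫ x in (0 : ℝ)..1, f x * pl n V x) +
      k ^ 2 * (∫ x in (0 : ℝ)..1, (u x - pl n (fun i => u (node n i)) x) * pl n V x) +
      γ * jumpForm k n (fun i => u (node n i)) V := by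
  have h1 := h.weak_form hn hV
  have hi : IntervalIntegrable (fun x => u x * pl n V x) volume 0 1 := by
    refine ContinuousOn.intervalIntegrable ?_
    rw [uIcc_of_le zero_le_one]
    exact (h.isPrimitive.continuousOn zero_le_one).mul (pl_continuousOn hn)
  have h2 : ∫ x in (0 : ℝ)..1, (u x - pl n (fun i => u (node n i)) x) * pl n V x =
      (∫ x in (0 : ℝ)..1, u x * pl n V x) -
        ∫ x in (0 : ℝ)..1, pl n (fun i => u (node n i)) x * pl n V x := by
    rw [← intervalIntegral.integral_sub hi (integrable_pl_mul hn)]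
    simp only [sub_mul]
  rw [cipBilin, h2, h1, node_self hn]
  ring

/-- Interpolation bounds for an exact solution. -/
lemma HelmholtzData.interpolation (hn : 0 < n) (hk : 1 ≤ k) (h : HelmholtzData k f u du d2u)
    (hf : IsL2On 0 1 f) :
    l2Norm (fun x => u x - pl n (fun i => u (node n i)) x) ≤
        (1 / n) ^ 2 * (5 / 2 * k * l2Norm f) ∧
      l2Norm (fun x => du x - plDeriv n (fun i => u (node n i)) x) ≤
        1 / n * (5 / 2 * k * l2Norm f) ∧
      jumpSq k n (fun i => u (node n i)) ≤ (5 * (1 / n) * k * l2Norm f) ^ 2 ∧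
      k * l2Norm (pl n (fun i => u (node n i))) ≤ 3 / 2 * l2Norm f := by
  have hd := h.l2Norm_d2u_le hk hf
  have hk0 : 0 ≤ k := by linarith
  have hd0 := l2Norm_nonneg d2u
  have hF := l2Norm_nonneg f
  refine ⟨?_, ?_, ?_, ?_⟩
  · exact (l2Norm_sub_pl_le hn h.isPrimitive h.isPrimitive' h.prim'.1).trans (by gcongr)
  · exact (l2Norm_sub_plDeriv_le hn h.isPrimitive h.isPrimitive' h.prim'.1).trans (by gcongr)
  · refine (sum_slopeJump_interpolant_le hn h.isPrimitive h.isPrimitive' h.prim'.1 h.right).trans ?_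
    have : 2 * (1 / (n : ℝ)) * l2Norm d2u ≤ 5 * (1 / n) * k * l2Norm f := by
      calc _ ≤ 2 * (1 / (n : ℝ)) * (5 / 2 * k * l2Norm f) := by gcongr
        _ = _ := by ring
    gcongr
  · have hkp : 0 < k := by linarith
    have h1 : l2Norm (pl n (fun i => u (node n i))) ≤ 3 / 2 * l2Norm f / k := by
      refine l2Norm_le_of_bound (by positivity) (fun x hx => pl_norm_le hn (fun j hj => ?_) hx)
        (pl_isL2On hn)
      rw [le_div_iff₀ hkp, mul_comm]
      exact h.norm_le hk0 hf (node_mem_Icc hj)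
    rw [le_div_iff₀ hkp] at h1
    linarith

/-- The discrete error satisfies the discrete problem with a small right hand side. -/
lemma cipBilin_error (hn : 0 < n) (h : HelmholtzData k f u du d2u)
    (hU : ∀ V : ℕ → ℂ, V 0 = 0 → cipBilin k γ n U V = ∫ x in (0 : ℝ)..1, f x * pl n V x)
    (hV : V 0 = 0) :
    cipBilin k γ n (fun i => u (node n i) - U i) V =
      k ^ 2 * (∫ x in (0 : ℝ)..1, (u x - pl n (fun i => u (node n i)) x) * pl n V x) +
      γ * jumpForm k n (fun i => u (node n i)) V := by
  have h1 := cipBilin_add_const_mul (k := k) (γ := γ) (U := fun i => u (node n i)) (V := U)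
    (W := V) hn (-1)
  have h2 : (fun i => u (node n i) - U i) = fun i => u (node n i) + (-1) * U i := by
    ext i; ring
  rw [h2, h1, cipBilin_interpolant hn h hV, hU V hV]
  ring

lemma sub_pl_isL2On (hn : 0 < n) (h : HelmholtzData k f u du d2u) :
    IsL2On 0 1 (fun x => u x - pl n (fun i => u (node n i)) x) :=
  MemLp.sub h.isL2On (pl_isL2On hn)

/-- Duality bound for the `L²` norm of a discrete function. -/
lemma duality_bound (hn : 0 < n) (hk : 1 ≤ k) (h : HelmholtzData k f u du d2u)
    (hf : IsL2On 0 1 f) {Θ : ℕ → ℂ} (hΘ0 : Θ 0 = 0)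
    (hΘ : ∀ V : ℕ → ℂ, V 0 = 0 → cipBilin k γ n Θ V =
      k ^ 2 * (∫ x in (0 : ℝ)..1, (u x - pl n (fun i => u (node n i)) x) * pl n V x) +
      γ * jumpForm k n (fun i => u (node n i)) V) {R : ℝ} (hR0 : 0 ≤ R)
    (hR : jumpSq k n Θ ≤ R ^ 2) :
    l2Norm (pl n Θ) ^ 2 ≤
      15 / 4 * k ^ 2 * (1 / n) ^ 2 * l2Norm f * l2Norm (pl n Θ) +
      25 * ‖γ‖ * k ^ 2 * (1 / n) ^ 2 * l2Norm f * l2Norm (pl n Θ) +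
      ‖γ‖ * (R * (5 * (1 / n) * k * l2Norm (pl n Θ))) +
      5 / 2 * (k ^ 3 * (1 / n) ^ 2) * l2Norm (pl n Θ) ^ 2 := by
  have hk0 : 0 < k := by linarith
  have hcont : ContinuousOn (fun x => conj (pl n Θ x)) (Icc 0 1) :=
    Complex.continuous_conj.comp_continuousOn (pl_continuousOn hn)
  -- Dual solution with the conjugate of the discrete function as data.
  obtain ⟨w, dw, d2w, hw⟩ := exists_helmholtzData hk0.ne' hcont
  have hg2 : IsL2On 0 1 (fun x => conj (pl n Θ x)) := (pl_isL2On hn).conj_comp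
  have hgT : l2Norm (fun x => conj (pl n Θ x)) = l2Norm (pl n Θ) := l2Norm_conj _
  obtain ⟨hw1, -, hw3, hw4⟩ := hw.interpolation hn hk hg2
  obtain ⟨hu1, -, hu3, -⟩ := h.interpolation hn hk hf
  rw [hgT] at hw1 hw3 hw4
  have hW0 : (fun i => w (node n i)) 0 = 0 := by simp [node_zero, hw.left]
  -- Testing the equation of the interpolant of `w` with `Θ` produces the squared norm; by symmetry
  -- its left side is the equation of `Θ` tested with that interpolant.
  have h1 := cipBilin_interpolant (γ := γ) hn hw hΘ0
  rw [cipBilin_comm, hΘ _ hW0] at h1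
  have h2 : ∫ x in (0 : ℝ)..1, conj (pl n Θ x) * pl n Θ x =
      ((l2Norm (pl n Θ) ^ 2 : ℝ) : ℂ) := by
    rw [← integral_pl_mul_conj]
    simp only [pl_conj, mul_comm]
  rw [h2] at h1
  set T := l2Norm (pl n Θ)
  set F := l2Norm f
  have hT : 0 ≤ T := l2Norm_nonneg _
  have hF : 0 ≤ F := l2Norm_nonneg _
  have e1 := norm_integral_mul_le (sub_pl_isL2On hn h)
    (pl_isL2On (U := fun i => w (node n i)) hn)
  have e2 := norm_integral_mul_le (sub_pl_isL2On hn hw) (pl_isL2On (U := Θ) hn)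
  have e3 := norm_jumpForm_le (by positivity) (by positivity) hu3 hw3
  have e4 := norm_jumpForm_le hR0 (by positivity) hw3 hR
  set I1 := ∫ x in (0 : ℝ)..1, (u x - pl n (fun i => u (node n i)) x) *
    pl n (fun i => w (node n i)) x
  set I2 := ∫ x in (0 : ℝ)..1, (w x - pl n (fun i => w (node n i)) x) * pl n Θ x
  set J1 := jumpForm k n (fun i => u (node n i)) (fun i => w (node n i))
  set J2 := jumpForm k n (fun i => w (node n i)) Θ
  have e5 : ((T ^ 2 : ℝ) : ℂ) = k ^ 2 * I1 + γ * J1 - γ * J2 - k ^ 2 * I2 := by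
    linear_combination -h1
  have e6 : T ^ 2 ≤ k ^ 2 * ‖I1‖ + ‖γ‖ * ‖J1‖ + ‖γ‖ * ‖J2‖ + k ^ 2 * ‖I2‖ := by
    calc T ^ 2 = ‖((T ^ 2 : ℝ) : ℂ)‖ := by
          rw [Complex.norm_real, Real.norm_of_nonneg (by positivity)]
      _ ≤ ‖(k : ℂ) ^ 2 * I1‖ + ‖γ * J1‖ + ‖γ * J2‖ + ‖(k : ℂ) ^ 2 * I2‖ := by
          rw [e5]
          refine (norm_sub_le _ _).trans ?_
          gcongr
          refine (norm_sub_le _ _).trans ?_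
          gcongr
          exact norm_add_le _ _
      _ = _ := by
          simp only [norm_mul, norm_pow, Complex.norm_real, Real.norm_of_nonneg hk0.le]
  have e7 : k ^ 2 * ‖I1‖ ≤ 15 / 4 * k ^ 2 * (1 / n) ^ 2 * F * T := by
    calc k ^ 2 * ‖I1‖ ≤ k ^ 2 * ((1 / n) ^ 2 * (5 / 2 * k * F) *
          l2Norm (pl n (fun i => w (node n i)))) := by
          have := l2Norm_nonneg (pl n (fun i => w (node n i)))
          gcongr
          exact e1.trans (by gcongr)
      _ = k ^ 2 * ((1 / n) ^ 2 * (5 / 2 * F)) * (k * l2Norm (pl n (fun i => w (node n i)))) := by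
          ring
      _ ≤ k ^ 2 * ((1 / n) ^ 2 * (5 / 2 * F)) * (3 / 2 * T) := by gcongr
      _ = _ := by ring
  have e8 : k ^ 2 * ‖I2‖ ≤ 5 / 2 * (k ^ 3 * (1 / n) ^ 2) * T ^ 2 := by
    calc k ^ 2 * ‖I2‖ ≤ k ^ 2 * ((1 / n) ^ 2 * (5 / 2 * k * T) * T) := by
          gcongr
          exact e2.trans (by gcongr)
      _ = _ := by ring
  have e9 : ‖γ‖ * ‖J1‖ ≤ 25 * ‖γ‖ * k ^ 2 * (1 / n) ^ 2 * F * T := by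
    calc _ ≤ ‖γ‖ * (5 * (1 / n) * k * F * (5 * (1 / n) * k * T)) := by gcongr
      _ = _ := by ring
  have e10 : ‖γ‖ * ‖J2‖ ≤ ‖γ‖ * (R * (5 * (1 / n) * k * T)) := by
    calc _ ≤ ‖γ‖ * (5 * (1 / n) * k * T * R) := by gcongr
      _ = _ := by ring
  linarith

/-- Energy bound for the discrete error. -/
lemma energy_bound (hn : 0 < n) (hk : 1 ≤ k) (hM1 : 1 ≤ M) (hγ : γ.im < 0)
    (hM : ‖γ‖ ≤ M * |γ.im|) (hc : ‖γ‖ * (k * (1 / n)) ≤ 1 / (2 * (1 + 2 * M ^ 2)))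
    (h : HelmholtzData k f u du d2u)
    (hf : IsL2On 0 1 f) {Θ : ℕ → ℂ} (hΘ0 : Θ 0 = 0)
    (hΘ : ∀ V : ℕ → ℂ, V 0 = 0 → cipBilin k γ n Θ V =
      k ^ 2 * (∫ x in (0 : ℝ)..1, (u x - pl n (fun i => u (node n i)) x) * pl n V x) +
      γ * jumpForm k n (fun i => u (node n i)) V) :
    dissipation k γ n Θ ≤ 5 * (k ^ 3 * (1 / n) ^ 2) * l2Norm f * l2Norm (pl n Θ) +
        100 * M * ‖γ‖ * (k * (1 / n)) ^ 2 * l2Norm f ^ 2 ∧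
      ‖cipBilin k γ n Θ (fun i => conj (Θ i))‖ ≤
        5 / 2 * (k ^ 3 * (1 / n) ^ 2) * l2Norm f * l2Norm (pl n Θ) +
        dissipation k γ n Θ / 2 + 50 * M * ‖γ‖ * (k * (1 / n)) ^ 2 * l2Norm f ^ 2 := by
  have hk0 : 0 < k := by linarith
  obtain ⟨hu1, -, hu3, -⟩ := h.interpolation hn hk hf
  have hQ0 := dissipation_nonneg (γ := γ) (n := n) (U := Θ) hk0.le
  have hQ := dissipation_le (U := Θ) hn hk0.le hγ hM hc
  have hJ := norm_mul_jumpSq_le (U := Θ) hn hk0.le hM1 hM hc (l := -k) (by ring)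
  have hB := hΘ (fun i => conj (Θ i)) (by simp [hΘ0])
  have e1 := norm_integral_mul_le (sub_pl_isL2On hn h)
    (pl_isL2On (U := fun i => conj (Θ i)) hn)
  have e0 : l2Norm (pl n (fun i => conj (Θ i))) = l2Norm (pl n Θ) := by
    rw [← l2Norm_conj (pl n Θ)]
    congr 1; ext x; exact pl_conj x
  rw [e0] at e1
  have e2 := norm_jumpForm_sq_le (k := k) (n := n) (U := fun i => u (node n i))
    (V := fun i => conj (Θ i))
  rw [jumpSq_conj] at e2
  set T := l2Norm (pl n Θ)
  set F := l2Norm f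
  have hT : 0 ≤ T := l2Norm_nonneg _
  have hF : 0 ≤ F := l2Norm_nonneg _
  set Q := dissipation k γ n Θ
  set J := jumpForm k n (fun i => u (node n i)) (fun i => conj (Θ i))
  set I := ∫ x in (0 : ℝ)..1, (u x - pl n (fun i => u (node n i)) x) *
    pl n (fun i => conj (Θ i)) x
  -- Arithmetic–geometric mean inequality, arranged so that only half of the dissipation appears and
  -- can be absorbed.
  have e3 : ‖γ‖ * ‖J‖ ≤ Q / 2 + 50 * M * ‖γ‖ * (k * (1 / n)) ^ 2 * F ^ 2 := by
    refine abs_le_of_sq_le_sq' ?_ (by positivity) |>.2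
    calc (‖γ‖ * ‖J‖) ^ 2 = ‖γ‖ ^ 2 * ‖J‖ ^ 2 := by ring
      _ ≤ ‖γ‖ ^ 2 * ((5 * (1 / n) * k * F) ^ 2 * jumpSq (-k) n Θ) := by
          have := jumpSq_nonneg (k := -k) (n := n) (U := Θ)
          gcongr
          exact e2.trans (by gcongr)
      _ = ‖γ‖ * (5 * (1 / n) * k * F) ^ 2 * (‖γ‖ * jumpSq (-k) n Θ) := by ring
      _ ≤ ‖γ‖ * (5 * (1 / n) * k * F) ^ 2 * (4 * M * Q) := by gcongr
      _ = 4 * (Q / 2) * (50 * M * ‖γ‖ * (k * (1 / n)) ^ 2 * F ^ 2) := by ring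
      _ ≤ _ := by
          nlinarith [sq_nonneg (Q / 2 - 50 * M * ‖γ‖ * (k * (1 / n)) ^ 2 * F ^ 2)]
  have e4 : ‖cipBilin k γ n Θ (fun i => conj (Θ i))‖ ≤
      5 / 2 * (k ^ 3 * (1 / n) ^ 2) * F * T + ‖γ‖ * ‖J‖ := by
    rw [hB]
    refine (norm_add_le _ _).trans ?_
    rw [norm_mul, norm_mul, norm_pow, Complex.norm_real, Real.norm_of_nonneg hk0.le]
    refine add_le_add_left ?_ _
    calc k ^ 2 * ‖I‖ ≤ k ^ 2 * ((1 / n) ^ 2 * (5 / 2 * k * F) * T) := by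
          gcongr
          exact e1.trans (by gcongr)
      _ = _ := by ring
  have e5 : Q ≤ ‖cipBilin k γ n Θ (fun i => conj (Θ i))‖ :=
    hQ.trans ((neg_le_abs _).trans (Complex.abs_im_le_norm _))
  constructor <;> linarith

/-- Arithmetic of the bound for the derivative of the discrete error. -/
lemma gradient_bound_arith {D B T F Q G p t : ℝ} (hk : 1 ≤ k) (hM1 : 1 ≤ M) (hG : 0 ≤ G)
    (hp0 : 0 ≤ p) (ht0 : 0 ≤ t) (hT : 0 ≤ T) (hF : 0 ≤ F)
    (hkT : k * T ≤ 550 * M * (1 + G) * p * F)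
    (hQ : Q ≤ 5 * p * F * T + 100 * M * G * t ^ 2 * F ^ 2)
    (hB : B ≤ 5 / 2 * p * F * T + Q / 2 + 50 * M * G * t ^ 2 * F ^ 2)
    (hD : D - k ^ 2 * T ^ 2 ≤ B + 4 * M * Q) :
    D ≤ (600 * M * (1 + G) * (t + p) * F) ^ 2 := by
  have hTp : T ≤ 550 * M * (1 + G) * p * F := le_trans (le_mul_of_one_le_left hT hk) hkT
  have hMM : M ≤ M ^ 2 := by nlinarith
  have hGG : 1 + G ≤ (1 + G) ^ 2 := by nlinarith
  have hGG' : G ≤ (1 + G) ^ 2 := by nlinarith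
  have e1 : D ≤ (k * T) ^ 2 + 28 * M * (p * F * T) + 550 * M ^ 2 * G * t ^ 2 * F ^ 2 := by
    have a1 : 0 ≤ p * F * T := by positivity
    have a3 : (4 * M + 1 / 2) * Q ≤ (4 * M + 1 / 2) * (5 * p * F * T +
      100 * M * G * t ^ 2 * F ^ 2) := by gcongr
    have a4 : p * F * T ≤ M * (p * F * T) := le_mul_of_one_le_left a1 hM1
    have a5 : M * (G * t ^ 2 * F ^ 2) ≤ M ^ 2 * (G * t ^ 2 * F ^ 2) := by gcongr
    have a6 : 0 ≤ M ^ 2 * (G * t ^ 2 * F ^ 2) := by positivity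
    linarith
  have e2 : (k * T) ^ 2 ≤ (550 * M * (1 + G) * p * F) ^ 2 := by gcongr
  have e3 : 28 * M * (p * F * T) ≤ 28 * M * (p * F * (550 * M * (1 + G) * p * F)) := by gcongr
  have e4 : M ^ 2 * (1 + G) * (p * F) ^ 2 ≤ M ^ 2 * (1 + G) ^ 2 * (p * F) ^ 2 := by gcongr
  have e5 : M ^ 2 * G * (t * F) ^ 2 ≤ M ^ 2 * (1 + G) ^ 2 * (t * F) ^ 2 := by gcongr
  have e6 : 0 ≤ M ^ 2 * (1 + G) ^ 2 * (t * F) * (p * F) := by positivity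
  have e7 : 0 ≤ M ^ 2 * (1 + G) ^ 2 * (t * F) ^ 2 := by positivity
  have e8 : 0 ≤ M ^ 2 * (1 + G) ^ 2 * (p * F) ^ 2 := by positivity
  linarith

/-- Preasymptotic bound for the discrete error. -/
lemma discrete_error_bound (hn : 0 < n) (hk : 1 ≤ k) (hM1 : 1 ≤ M) (hγ : γ.im < 0)
    (hM : ‖γ‖ ≤ M * |γ.im|) (hc : ‖γ‖ * (k * (1 / n)) ≤ 1 / (2 * (1 + 2 * M ^ 2)))
    (hp : k ^ 3 * (1 / (n : ℝ)) ^ 2 ≤ 1 / 7)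
    (h : HelmholtzData k f u du d2u)
    (hf : IsL2On 0 1 f) {Θ : ℕ → ℂ} (hΘ0 : Θ 0 = 0)
    (hΘ : ∀ V : ℕ → ℂ, V 0 = 0 → cipBilin k γ n Θ V =
      k ^ 2 * (∫ x in (0 : ℝ)..1, (u x - pl n (fun i => u (node n i)) x) * pl n V x) +
      γ * jumpForm k n (fun i => u (node n i)) V) :
    k * l2Norm (pl n Θ) ≤ 550 * M * (1 + ‖γ‖) * (k ^ 3 * (1 / n) ^ 2) * l2Norm f ∧
      slopeSq n Θ ≤
        (600 * M * (1 + ‖γ‖) * (k * (1 / n) + k ^ 3 * (1 / n) ^ 2) * l2Norm f) ^ 2 := by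
  have hk0 : 0 < k := by linarith
  obtain ⟨hQ, hB⟩ := energy_bound hn hk hM1 hγ hM hc h hf hΘ0 hΘ
  have hD := duality_bound (R := √(jumpSq k n Θ)) hn hk h hf hΘ0 hΘ (Real.sqrt_nonneg _)
    (Real.sq_sqrt jumpSq_nonneg).ge
  have hR2 : √(jumpSq k n Θ) ^ 2 = jumpSq k n Θ := Real.sq_sqrt jumpSq_nonneg
  have hR0 := Real.sqrt_nonneg (jumpSq k n Θ)
  have hJ := norm_mul_jumpSq_le (U := Θ) hn hk0.le hM1 hM hc (l := k) rfl
  have hS := abs_slopeSq_sub_le (U := Θ) hn hk0.le hM1 hM hc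
  have hQ0 := dissipation_nonneg (γ := γ) (n := n) (U := Θ) hk0.le
  rw [← hR2] at hJ
  set R := √(jumpSq k n Θ)
  set T := l2Norm (pl n Θ)
  set F := l2Norm f
  have hT : 0 ≤ T := l2Norm_nonneg _
  have hF : 0 ≤ F := l2Norm_nonneg _
  set Q := dissipation k γ n Θ
  set G := ‖γ‖
  have hG : 0 ≤ G := norm_nonneg _
  set t := k * (1 / (n : ℝ)) with ht
  have ht0 : 0 ≤ t := by positivity
  have hpt : k ^ 3 * (1 / (n : ℝ)) ^ 2 = k * t ^ 2 := by rw [ht]; ring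
  have hkt : k ^ 2 * (1 / (n : ℝ)) ^ 2 = t ^ 2 := by rw [ht]; ring
  rw [hpt] at hp hQ hB hD ⊢
  have hM0 : 0 < M := by linarith
  -- The jumps of `Θ` are replaced by the energy bound. The square is completed so that the mixed
  -- term costs only `k * t ^ 2 * T`.
  have hY : G * (R * (5 * t * T)) ≤ T * (250 * M * (G * t ^ 2 * F) + k * t ^ 2 * T) := by
    refine abs_le_of_sq_le_sq' ?_ (by positivity) |>.2
    calc (G * (R * (5 * t * T))) ^ 2 = 25 * t ^ 2 * T ^ 2 * G * (G * R ^ 2) := by ring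
      _ ≤ 25 * t ^ 2 * T ^ 2 * G * (4 * M * Q) := by gcongr
      _ ≤ 25 * t ^ 2 * T ^ 2 * G * (4 * M * (5 * (k * t ^ 2) * F * T +
            100 * M * G * t ^ 2 * F ^ 2)) := by gcongr
      _ = T ^ 2 * (500 * M * (G * t ^ 2 * F) * (k * t ^ 2 * T) +
            10000 * M ^ 2 * (G * t ^ 2 * F) ^ 2) := by ring
      _ ≤ T ^ 2 * (500 * M * (G * t ^ 2 * F) * (k * t ^ 2 * T) +
            62500 * M ^ 2 * (G * t ^ 2 * F) ^ 2 + (k * t ^ 2 * T) ^ 2) := by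
          refine mul_le_mul_of_nonneg_left ?_ (sq_nonneg T)
          have h1 : 0 ≤ M ^ 2 * (G * t ^ 2 * F) ^ 2 := by positivity
          have h2 := sq_nonneg (k * t ^ 2 * T)
          linarith
      _ = _ := by ring
  -- Here 7/2 is 5/2 from the duality bound plus 1 from `hY`. With k³h² ≤ 1/7 half of `T` is
  -- absorbed, and 2(25 + 250) = 550 gives the constant in `hTb`.
  have hD' : T * T ≤ T * (15 / 4 * t ^ 2 * F + 25 * (G * t ^ 2 * F) +
      250 * M * (G * t ^ 2 * F) + 7 / 2 * (k * t ^ 2) * T) := by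
    have e1 : 15 / 4 * k ^ 2 * (1 / (n : ℝ)) ^ 2 * F * T = T * (15 / 4 * t ^ 2 * F) := by
      rw [← hkt]; ring
    have e2 : 25 * G * k ^ 2 * (1 / (n : ℝ)) ^ 2 * F * T = T * (25 * (G * t ^ 2 * F)) := by
      rw [← hkt]; ring
    have e3 : 5 * (1 / (n : ℝ)) * k * T = 5 * t * T := by rw [ht]; ring
    rw [e1, e2, e3] at hD
    linarith
  have hTb : T ≤ 550 * M * (1 + G) * (t ^ 2 * F) := by
    rcases hT.eq_or_lt with h0 | h0
    · rw [← h0]; positivity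
    have h1 := le_of_mul_le_mul_left hD' h0
    have h2 : k * t ^ 2 * T ≤ 1 / 7 * T := by gcongr
    have h3 : G * t ^ 2 * F ≤ M * (G * t ^ 2 * F) := le_mul_of_one_le_left (by positivity) hM1
    have h4 : t ^ 2 * F ≤ M * (t ^ 2 * F) := le_mul_of_one_le_left (by positivity) hM1
    have h5 : 0 ≤ M * (t ^ 2 * F) := by positivity
    linarith
  have hkT : k * T ≤ 550 * M * (1 + G) * (k * t ^ 2) * F := by
    calc k * T ≤ k * (550 * M * (1 + G) * (t ^ 2 * F)) := by gcongr
      _ = _ := by ring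
  refine ⟨hkT, ?_⟩
  exact gradient_bound_arith hk hM1 hG (by positivity) ht0 hT hF hkT hQ hB (abs_le.1 hS).2

end Error

/-! ### Finite element functions and nodal values -/

/-- Nodal values with the homogeneous condition at the left endpoint. -/
def extendNodal (n : ℕ) : (Fin n → ℂ) →ₗ[ℂ] (ℕ → ℂ) where
  toFun c j := if h : 0 < j ∧ j ≤ n then c ⟨j - 1, by omega⟩ else 0
  map_add' c d := by ext j; by_cases h : 0 < j ∧ j ≤ n <;> simp [h]
  map_smul' a c := by ext j; by_cases h : 0 < j ∧ j ≤ n <;> simp [h]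

lemma extendNodal_zero (c : Fin n → ℂ) : extendNodal n c 0 = 0 := by simp [extendNodal]

lemma extendNodal_succ (c : Fin n → ℂ) (i : Fin n) : extendNodal n c (i + 1) = c i := by
  simp [extendNodal, Nat.succ_le_of_lt i.2]

lemma extendNodal_conj (c : Fin n → ℂ) :
    extendNodal n (fun i => conj (c i)) = fun j => conj (extendNodal n c j) := by
  ext j
  by_cases h : 0 < j ∧ j ≤ n <;> simp [extendNodal, h]

lemma pl_mem_FESpace (hn : 0 < n) (hU : U 0 = 0) : pl n U ∈ FESpace n := by
  refine ⟨⟨plDeriv n U, plDeriv_isL2On hn, (isPrimitive_pl hn).2⟩, by rw [pl_zero hn, hU],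
    fun j _ => ⟨U j - j * (U (j + 1) - U j), n * (U (j + 1) - U j), fun x hx => ?_⟩⟩
  rw [pl_eq hn (Ioo_subset_Icc_self hx)]
  ring

lemma exists_nodal_of_mem_FESpace (hn : 0 < n) {v : ℝ → ℂ} (hv : v ∈ FESpace n) :
    ∃ c : Fin n → ℂ, ∀ x ∈ Icc (0 : ℝ) 1, v x = pl n (extendNodal n c) x := by
  have hn' : (0 : ℝ) < n := by exact_mod_cast hn
  obtain ⟨⟨g, hg⟩, h0, hcell⟩ := hv
  have hcont : ContinuousOn v (Icc 0 1) :=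
    (hg.isPrimitive zero_le_one).continuousOn zero_le_one
  refine ⟨fun i => v (node n (i + 1)), fun x hx => ?_⟩
  have hE : ∀ j ≤ n, extendNodal n (fun i : Fin n => v (node n (i + 1))) j = v (node n j) := by
    intro j hj
    rcases j with _ | j
    · rw [extendNodal_zero, node_zero, h0]
    · exact extendNodal_succ _ (⟨j, hj⟩ : Fin n)
  obtain ⟨j, hj, hxj⟩ := exists_cell hn hx
  obtain ⟨a, b, hab⟩ := hcell j hj
  -- The affine formula holds on the open cell only; continuity extends it to the nodes.
  have hcl : EqOn v (fun x : ℝ => a + b * x) (cell n j) := by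
    refine EqOn.of_subset_closure (s := Ioo (node n j) (node n (j + 1))) hab
      (hcont.mono (cell_subset hj)) (by fun_prop) Ioo_subset_Icc_self ?_
    rw [closure_Ioo (node_lt_succ hn j).ne]
  rw [pl_eq hn hxj, hE j hj.le, hE (j + 1) hj, hcl hxj, hcl (left_mem_cell j),
    hcl (right_mem_cell j)]
  have h1 : (n : ℂ) * node n j = j := by exact_mod_cast mul_node hn j
  have h2 : (n : ℂ) * node n (j + 1) = j + 1 := by exact_mod_cast mul_node hn (j + 1)
  dsimp only
  linear_combination -b * (x - node n j) * (h2 - h1) - b * (node n (j + 1) - node n j) * h1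

lemma hasDerivAt_of_eq_pl (hn : 0 < n) {v : ℝ → ℂ} (hv : ∀ x ∈ Icc (0 : ℝ) 1, v x = pl n U x)
    {j : ℕ} (hj : j < n) {x : ℝ} (hx : x ∈ Ioo (node n j) (node n (j + 1))) :
    HasDerivAt v (cellSlope n U j) x := by
  have h1 : HasDerivAt (fun x : ℝ => U j + ((n : ℂ) * x - j) * (U (j + 1) - U j))
      (cellSlope n U j) x := by
    have := ((((Complex.ofRealCLM.hasDerivAt (x := x)).const_mul (n : ℂ)).sub_const
      (j : ℂ)).mul_const (U (j + 1) - U j)).const_add (U j)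
    refine this.congr_deriv ?_
    simp [cellSlope]
  refine h1.congr_of_eventuallyEq ?_
  filter_upwards [Ioo_mem_nhds hx.1 hx.2] with y hy
  rw [hv y (cell_subset hj (Ioo_subset_Icc_self hy)), pl_eq hn (Ioo_subset_Icc_self hy)]

lemma leftLim_deriv (hn : 0 < n) {v : ℝ → ℂ} (hv : ∀ x ∈ Icc (0 : ℝ) 1, v x = pl n U x)
    {j : ℕ} (hj : j < n) : Function.leftLim (deriv v) (node n (j + 1)) = cellSlope n U j := by
  refine leftLim_eq_of_tendsto (tendsto_const_nhds.congr' ?_)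
  filter_upwards [Ioo_mem_nhdsLT (node_lt_succ hn j)] with x hx
  exact (hasDerivAt_of_eq_pl hn hv hj hx).deriv.symm

lemma rightLim_deriv (hn : 0 < n) {v : ℝ → ℂ} (hv : ∀ x ∈ Icc (0 : ℝ) 1, v x = pl n U x)
    {j : ℕ} (hj : j < n) : Function.rightLim (deriv v) (node n j) = cellSlope n U j := by
  refine rightLim_eq_of_tendsto (tendsto_const_nhds.congr' ?_)
  filter_upwards [Ioo_mem_nhdsGT (node_lt_succ hn j)] with x hx
  exact (hasDerivAt_of_eq_pl hn hv hj hx).deriv.symm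

lemma ae_mem_open_cell (hn : 0 < n) :
    ∀ᵐ x : ℝ, x ∈ Ioc (0 : ℝ) 1 → ∃ j < n, x ∈ Ioo (node n j) (node n (j + 1)) := by
  have h : ∀ᵐ x : ℝ, ∀ j : ℕ, x ≠ node n j :=
    ae_all_iff.2 fun j => by simp [ae_iff, measure_singleton]
  filter_upwards [h] with x hx hx1
  obtain ⟨j, hj, hxj⟩ := exists_cell hn (Ioc_subset_Icc_self hx1)
  exact ⟨j, hj, lt_of_le_of_ne hxj.1 (hx j).symm, lt_of_le_of_ne hxj.2 (hx (j + 1))⟩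

lemma ae_deriv_eq_plDeriv (hn : 0 < n) {v : ℝ → ℂ} (hv : ∀ x ∈ Icc (0 : ℝ) 1, v x = pl n U x) :
    ∀ᵐ x : ℝ, x ∈ Ioc (0 : ℝ) 1 → deriv v x = plDeriv n U x := by
  filter_upwards [ae_mem_open_cell hn] with x hx hx1
  obtain ⟨j, hj, hxj⟩ := hx hx1
  rw [(hasDerivAt_of_eq_pl hn hv hj hxj).deriv, plDeriv_eq hn (Ioo_subset_Ico_self hxj)]

lemma plDeriv_conj (x : ℝ) : plDeriv n (fun j => conj (U j)) x = conj (plDeriv n U x) :=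
  cellSlope_conj _

lemma penaltyForm_eq (hn : 0 < n) {v w : ℝ → ℂ} (hv : ∀ x ∈ Icc (0 : ℝ) 1, v x = pl n U x)
    (hw : ∀ x ∈ Icc (0 : ℝ) 1, w x = pl n V x) :
    penaltyForm k γ n v w = γ * jumpForm k n U (fun j => conj (V j)) := by
  obtain ⟨m, rfl⟩ := Nat.exists_eq_succ_of_ne_zero hn.ne'
  simp only [Nat.succ_eq_add_one] at *
  have hj : ∀ j < m, ∀ {W : ℕ → ℂ} {z : ℝ → ℂ}, (∀ x ∈ Icc (0 : ℝ) 1, z x = pl (m + 1) W x) →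
      jump (m + 1) (deriv z) (1 + j) = slopeJump k (m + 1) W j := fun j hj W z hz => by
    rw [jump, add_comm 1 j, leftLim_deriv hn hz (by omega), rightLim_deriv hn hz (by omega)]
    simp [slopeJump, hj]
  have hl : ∀ {W : ℕ → ℂ} {z : ℝ → ℂ}, (∀ x ∈ Icc (0 : ℝ) 1, z x = pl (m + 1) W x) →
      Function.leftLim (deriv z) 1 = cellSlope (m + 1) W m := fun {W z} hz => by
    rw [← leftLim_deriv hn hz (Nat.lt_succ_self m), node_self hn]
  have hone : (1 : ℝ) ∈ Icc (0 : ℝ) 1 := by simp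
  -- Conjugation commutes with interior jumps only. At the endpoint the second factor of the penalty
  -- already is the residual of the conjugated values, with ik not conjugated.
  have hc : ∀ j < m, slopeJump k (m + 1) (fun j => conj (V j)) j =
      conj (slopeJump k (m + 1) V j) := fun j hj => by
    simp only [slopeJump, add_lt_add_iff_right, hj, if_true, cellSlope_conj, map_sub]
  rw [penaltyForm, jumpForm, Finset.sum_range_succ, Finset.sum_Ico_eq_sum_range, hl hv, hl hw,
    hv 1 hone, hw 1 hone, pl_one hn, pl_one hn, add_tsub_cancel_right,
    Finset.sum_congr rfl fun j hj' => by
      rw [hj j (Finset.mem_range.1 hj') hv, hj j (Finset.mem_range.1 hj') hw,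
        ← hc j (Finset.mem_range.1 hj'), mul_assoc (γ * _)], ← Finset.mul_sum]
  simp only [slopeJump, lt_irrefl, if_false, cellSlope_conj]
  ring

lemma l2Inner_eq {v w : ℝ → ℂ} (hw : ∀ x ∈ Icc (0 : ℝ) 1, w x = pl n V x) :
    l2Inner v w = ∫ x in (0 : ℝ)..1, v x * pl n (fun j => conj (V j)) x := by
  refine intervalIntegral.integral_congr fun x hx => ?_
  rw [uIcc_of_le zero_le_one] at hx
  simp only [hw x hx, pl_conj]

lemma cipForm_eq (hn : 0 < n) {v w : ℝ → ℂ} (hv : ∀ x ∈ Icc (0 : ℝ) 1, v x = pl n U x)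
    (hw : ∀ x ∈ Icc (0 : ℝ) 1, w x = pl n V x) :
    cipForm k γ n v w = cipBilin k γ n U (fun j => conj (V j)) := by
  have hone : (1 : ℝ) ∈ Icc (0 : ℝ) 1 := by simp
  have h1 : l2Inner (deriv v) (deriv w) =
      1 / (n : ℂ) * ∑ j ∈ Finset.range n, cellSlope n U j *
        cellSlope n (fun j => conj (V j)) j := by
    rw [← integral_plDeriv_mul_plDeriv hn, l2Inner]
    refine intervalIntegral.integral_congr_ae ?_
    filter_upwards [ae_deriv_eq_plDeriv hn hv, ae_deriv_eq_plDeriv hn hw] with x hx hx' hx1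
    rw [uIoc_of_le zero_le_one] at hx1
    rw [hx hx1, hx' hx1, plDeriv_conj]
  have h2 : l2Inner v w = ∫ x in (0 : ℝ)..1, pl n U x * pl n (fun j => conj (V j)) x := by
    rw [l2Inner_eq hw]
    refine intervalIntegral.integral_congr fun x hx => ?_
    rw [uIcc_of_le zero_le_one] at hx
    simp only [hv x hx]
  rw [cipForm, h1, h2, penaltyForm_eq hn hv hw, hv 1 hone, hw 1 hone, pl_one hn, pl_one hn,
    cipBilin]

/-- Conjugation is a bijection of the nodal vectors, so testing the sesquilinear form with all of
V_h is testing the bilinear form with all nodal vectors. -/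
lemma isCIPSolution_iff (hn : 0 < n) {f v : ℝ → ℂ} {c : Fin n → ℂ}
    (hv : ∀ x ∈ Icc (0 : ℝ) 1, v x = pl n (extendNodal n c) x) (hmem : v ∈ FESpace n) :
    IsCIPSolution k γ n f v ↔ ∀ d : Fin n → ℂ,
      cipBilin k γ n (extendNodal n c) (extendNodal n d) =
        ∫ x in (0 : ℝ)..1, f x * pl n (extendNodal n d) x := by
  constructor
  · rintro ⟨-, h⟩ d
    have h1 := h (pl n (extendNodal n (fun i => conj (d i))))
      (pl_mem_FESpace hn (extendNodal_zero _))
    rw [cipForm_eq hn hv (fun _ _ => rfl), l2Inner_eq (fun _ _ => rfl), ← extendNodal_conj] at h1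
    simpa using h1
  · refine fun h => ⟨hmem, fun w hw => ?_⟩
    obtain ⟨d, hd⟩ := exists_nodal_of_mem_FESpace hn hw
    rw [cipForm_eq hn hv hd, l2Inner_eq hd, ← extendNodal_conj]
    exact h _

lemma cipBilin_add_left (hn : 0 < n) {W : ℕ → ℂ} :
    cipBilin k γ n (U + V) W = cipBilin k γ n U W + cipBilin k γ n V W := by
  have := cipBilin_add_const_mul (k := k) (γ := γ) (U := U) (V := V) (W := W) hn 1
  simp only [one_mul] at this
  exact this

lemma cipBilin_smul_left (hn : 0 < n) {W : ℕ → ℂ} (a : ℂ) :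
    cipBilin k γ n (a • V) W = a * cipBilin k γ n V W := by
  have h0 : cipBilin k γ n (fun _ => 0) W = 0 := by
    have := cipBilin_add_const_mul (k := k) (γ := γ) (U := fun _ => 0) (V := fun _ => 0)
      (W := W) hn 1
    simpa using this
  have := cipBilin_add_const_mul (k := k) (γ := γ) (U := fun _ => 0) (V := V) (W := W) hn a
  simp only [zero_add, h0] at this
  exact this

/-! ### Existence and uniqueness of the discrete solution -/

/-- The form as a bilinear map on nodal values. -/
noncomputable def cipBilinMap (k : ℝ) (γ : ℂ) (hn : 0 < n) :
    (Fin n → ℂ) →ₗ[ℂ] Module.Dual ℂ (Fin n → ℂ) :=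
  LinearMap.mk₂ ℂ (fun c d => cipBilin k γ n (extendNodal n c) (extendNodal n d))
    (fun c c' d => by rw [map_add, cipBilin_add_left hn])
    (fun a c d => by rw [map_smul, cipBilin_smul_left hn, smul_eq_mul])
    (fun c d d' => by
      rw [map_add, cipBilin_comm, cipBilin_add_left hn, cipBilin_comm,
        cipBilin_comm (U := extendNodal n d')])
    (fun a c d => by
      rw [map_smul, cipBilin_comm, cipBilin_smul_left hn, cipBilin_comm, smul_eq_mul])

lemma cipBilinMap_injective (hn : 0 < n) (hk : 1 ≤ k) (hM1 : 1 ≤ M) (hγ : γ.im < 0)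
    (hM : ‖γ‖ ≤ M * |γ.im|) (hc : ‖γ‖ * (k * (1 / n)) ≤ 1 / (2 * (1 + 2 * M ^ 2))) :
    Function.Injective (cipBilinMap k γ hn) := by
  refine (injective_iff_map_eq_zero _).2 fun c hc0 => ?_
  have h1 : cipBilin k γ n (extendNodal n c) (fun j => conj (extendNodal n c j)) = 0 := by
    rw [← extendNodal_conj]
    exact LinearMap.congr_fun hc0 (fun i => conj (c i))
  ext i
  have := eq_zero_of_cipBilin_conj_self hn hk hM1 hγ hM hc (extendNodal_zero c) h1
    (j := i + 1) i.2
  rwa [extendNodal_succ] at this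

/-- The load functional on nodal values. -/
noncomputable def loadFunctional (hn : 0 < n) {f : ℝ → ℂ} (hf : IsL2On 0 1 f) :
    Module.Dual ℂ (Fin n → ℂ) where
  toFun d := ∫ x in (0 : ℝ)..1, f x * pl n (extendNodal n d) x
  map_add' d d' := by
    have hi : ∀ d : Fin n → ℂ, IntervalIntegrable (fun x => f x * pl n (extendNodal n d) x)
        volume 0 1 := fun d =>
      (hf.intervalIntegrable zero_le_one).mul_continuousOn (by
        rw [uIcc_of_le zero_le_one]; exact pl_continuousOn hn)
    rw [← intervalIntegral.integral_add (hi d) (hi d')]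
    congr 1; ext x
    rw [map_add, ← mul_add, ← pl_add]; rfl
  map_smul' a d := by
    rw [RingHom.id_apply, smul_eq_mul, ← intervalIntegral.integral_const_mul]
    congr 1; ext x
    rw [map_smul, show a • extendNodal n d = fun j => a * extendNodal n d j from rfl,
      pl_const_mul]
    ring

/-- Injectivity of the form implies surjectivity onto the dual, which has the same dimension.
Equality is asserted on [0, 1] only, as values elsewhere are unconstrained. -/
lemma exists_unique_cipSolution (hn : 0 < n) (hk : 1 ≤ k) (hM1 : 1 ≤ M) (hγ : γ.im < 0)
    (hM : ‖γ‖ ≤ M * |γ.im|) (hc : ‖γ‖ * (k * (1 / n)) ≤ 1 / (2 * (1 + 2 * M ^ 2)))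
    {f : ℝ → ℂ} (hf : IsL2On 0 1 f) :
    ∃ uh : ℝ → ℂ, IsCIPSolution k γ n f uh ∧
      ∀ wh : ℝ → ℂ, IsCIPSolution k γ n f wh → EqOn wh uh (Icc 0 1) := by
  have hinj := cipBilinMap_injective hn hk hM1 hγ hM hc
  have hsurj : Function.Surjective (cipBilinMap k γ hn) :=
    (LinearMap.injective_iff_surjective_of_finrank_eq_finrank
      Subspace.dual_finrank_eq.symm).1 hinj
  obtain ⟨c, hc⟩ := hsurj (loadFunctional hn hf)
  refine ⟨pl n (extendNodal n c), (isCIPSolution_iff hn (fun _ _ => rfl)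
    (pl_mem_FESpace hn (extendNodal_zero c))).2 fun d => LinearMap.congr_fun hc d,
    fun wh hwh x hx => ?_⟩
  obtain ⟨c', hc'⟩ := exists_nodal_of_mem_FESpace hn hwh.1
  have h1 := (isCIPSolution_iff hn hc' hwh.1).1 hwh
  have h2 : cipBilinMap k γ hn c' = loadFunctional hn hf := LinearMap.ext h1
  rw [hc' x hx, hinj (h2.trans hc.symm)]

/-! ### The two regimes and the final estimate -/

section FinalEstimate

variable {f u du d2u : ℝ → ℂ}

lemma deriv_sub_eq_ae (hn : 0 < n) (h : HelmholtzData k f u du d2u) {uh : ℝ → ℂ}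
    (hv : ∀ x ∈ Icc (0 : ℝ) 1, uh x = pl n U x) :
    ∀ᵐ x : ℝ, x ∈ Ioc (0 : ℝ) 1 → deriv (fun x => u x - uh x) x = du x - plDeriv n U x := by
  filter_upwards [ae_mem_open_cell hn, h.isPrimitive.ae_hasDerivAt zero_le_one] with x hx hx2 hx1
  obtain ⟨j, hj, hxj⟩ := hx hx1
  rw [plDeriv_eq hn (Ioo_subset_Ico_self hxj)]
  exact ((hx2 (Ioc_subset_Icc_self hx1)).sub (hasDerivAt_of_eq_pl hn hv hj hxj)).deriv

lemma l2Norm_plDeriv_le (hn : 0 < n) {a : ℝ} (ha : 0 ≤ a) (h : slopeSq n U ≤ a ^ 2) :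
    l2Norm (plDeriv n U) ≤ a := by
  rw [slopeSq_eq hn] at h
  exact abs_le_of_sq_le_sq' h ha |>.2

/-- The error bound in terms of the nodal values of the discrete solution. -/
lemma nodal_error_bound (hn : 0 < n) (hk : 1 ≤ k) (hM1 : 1 ≤ M) (hγ : γ.im < 0)
    (hM : ‖γ‖ ≤ M * |γ.im|) (hc : ‖γ‖ * (k * (1 / n)) ≤ 1 / (2 * (1 + 2 * M ^ 2)))
    (h : HelmholtzData k f u du d2u) (hf : IsL2On 0 1 f) (hU0 : U 0 = 0)
    (hU : ∀ V : ℕ → ℂ, V 0 = 0 → cipBilin k γ n U V = ∫ x in (0 : ℝ)..1, f x * pl n V x) :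
    k * l2Norm (fun x => u x - pl n U x) ≤ 2000 * M * (‖γ‖ + ‖γ‖⁻¹) *
        min 1 (k ^ 3 * (1 / (n : ℝ)) ^ 2) * l2Norm f ∧
      l2Norm (fun x => du x - plDeriv n U x) ≤ 2000 * M * (‖γ‖ + ‖γ‖⁻¹) *
        (k * (1 / (n : ℝ)) + min 1 (k ^ 3 * (1 / (n : ℝ)) ^ 2)) * l2Norm f := by
  have hk0 : 0 < k := by linarith
  have hn' : (0 : ℝ) < n := by exact_mod_cast hn
  have hM0 : 0 < M := by linarith
  have hF : 0 ≤ l2Norm f := l2Norm_nonneg f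
  have hG : 0 < ‖γ‖ := norm_pos_iff.2 fun h0 => by simp [h0] at hγ
  have hg : 0 < |γ.im| := abs_pos.2 hγ.ne
  have hGinv : ‖γ‖ * ‖γ‖⁻¹ = 1 := mul_inv_cancel₀ hG.ne'
  have hGi : 0 < ‖γ‖⁻¹ := inv_pos.2 hG
  -- This lets terms free of γ be absorbed into the factor `‖γ‖ + ‖γ‖⁻¹`.
  have hA : 2 ≤ ‖γ‖ + ‖γ‖⁻¹ := by nlinarith [sq_nonneg (‖γ‖ - ‖γ‖⁻¹)]
  -- Below the threshold the duality argument applies; above it the minimum is at least 1/7 and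
  -- stability of both solutions suffices.
  rcases le_total (k ^ 3 * (1 / (n : ℝ)) ^ 2) (1 / 7) with hp | hp
  · set Θ : ℕ → ℂ := fun i => u (node n i) - U i
    have hΘ0 : Θ 0 = 0 := by simp [Θ, node_zero, h.left, hU0]
    obtain ⟨h1, h2⟩ := discrete_error_bound hn hk hM1 hγ hM hc hp h hf hΘ0
      fun V hV => cipBilin_error hn h hU hV
    obtain ⟨h3, h4, -, -⟩ := h.interpolation hn hk hf
    have h5 : l2Norm (fun x => u x - pl n U x) ≤
        l2Norm (fun x => u x - pl n (fun i => u (node n i)) x) + l2Norm (pl n Θ) := by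
      refine le_trans (le_of_eq ?_) (l2Norm_add_le (sub_pl_isL2On hn h) (pl_isL2On hn))
      congr 1; ext x
      rw [pl_sub]; ring
    have h6 : l2Norm (fun x => du x - plDeriv n U x) ≤
        l2Norm (fun x => du x - plDeriv n (fun i => u (node n i)) x) +
          l2Norm (plDeriv n Θ) := by
      refine le_trans (le_of_eq ?_) (l2Norm_add_le (MemLp.sub
        (IsL2On.of_continuousOn (h.isPrimitive'.continuousOn zero_le_one)) (plDeriv_isL2On hn))
        (plDeriv_isL2On hn))
      congr 1; ext x
      simp only [plDeriv, Θ, cellSlope_sub]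
      ring
    have h7 := l2Norm_plDeriv_le hn (by positivity) h2
    rw [min_eq_right (hp.trans (by norm_num))]
    set t := k * (1 / (n : ℝ)) with ht
    have ht0 : 0 ≤ t := by positivity
    have hpt : k ^ 3 * (1 / (n : ℝ)) ^ 2 = k * t ^ 2 := by rw [ht]; ring
    rw [hpt] at h1 h2 h7 ⊢
    set F := l2Norm f
    set A := ‖γ‖ + ‖γ‖⁻¹
    have hGA : 1 + ‖γ‖ ≤ 3 / 2 * A := by
      have : ‖γ‖ ≤ A := by simp only [A]; linarith
      linarith
    have hMA : 1 ≤ M * A := by nlinarith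
    constructor
    · calc k * l2Norm (fun x => u x - pl n U x)
          ≤ k * (l2Norm (fun x => u x - pl n (fun i => u (node n i)) x)) +
            k * l2Norm (pl n Θ) := by rw [← mul_add]; gcongr
        _ ≤ k * ((1 / n) ^ 2 * (5 / 2 * k * F)) +
            550 * M * (1 + ‖γ‖) * (k * t ^ 2) * F :=
            add_le_add (mul_le_mul_of_nonneg_left h3 hk0.le) h1
        _ = 5 / 2 * (t ^ 2 * F) + 550 * M * (1 + ‖γ‖) * (k * t ^ 2) * F := by rw [ht]; ring
        _ ≤ 5 / 2 * (M * A * (k * (t ^ 2 * F))) +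
            550 * M * (3 / 2 * A) * (k * t ^ 2) * F := by
            have e1 : t ^ 2 * F ≤ k * (t ^ 2 * F) := le_mul_of_one_le_left (by positivity) hk
            have e2 : k * (t ^ 2 * F) ≤ M * A * (k * (t ^ 2 * F)) :=
              le_mul_of_one_le_left (by positivity) hMA
            have e3 : 550 * M * (1 + ‖γ‖) * (k * t ^ 2) * F ≤
              550 * M * (3 / 2 * A) * (k * t ^ 2) * F := by gcongr
            linarith
        _ ≤ _ := by
            have : 0 ≤ M * A * (k * (t ^ 2 * F)) := by positivity
            linarith
    · calc l2Norm (fun x => du x - plDeriv n U x)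
          ≤ 1 / n * (5 / 2 * k * F) + 600 * M * (1 + ‖γ‖) * (t + k * t ^ 2) * F :=
            h6.trans (add_le_add h4 h7)
        _ = 5 / 2 * (t * F) + 600 * M * (1 + ‖γ‖) * (t + k * t ^ 2) * F := by rw [ht]; ring
        _ ≤ 5 / 2 * (M * A * (t * F)) + 600 * M * (3 / 2 * A) * (t + k * t ^ 2) * F := by
            have e2 : t * F ≤ M * A * (t * F) := le_mul_of_one_le_left (by positivity) hMA
            have e3 : 600 * M * (1 + ‖γ‖) * (t + k * t ^ 2) * F ≤
              600 * M * (3 / 2 * A) * (t + k * t ^ 2) * F := by gcongr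
            linarith
        _ ≤ _ := by
            have : 0 ≤ M * A * (t * F) := by positivity
            have : 0 ≤ M * A * (k * t ^ 2 * F) := by positivity
            linarith
  · have hU0' : (fun i => conj (U i)) 0 = 0 := by simp [hU0]
    have hB : ‖cipBilin k γ n U (fun i => conj (U i))‖ ≤ l2Norm f * l2Norm (pl n U) := by
      rw [hU _ hU0']
      refine (norm_integral_mul_le hf (pl_isL2On hn)).trans (le_of_eq ?_)
      rw [← l2Norm_conj (pl n U)]
      congr 2; ext x; exact pl_conj x
    obtain ⟨h1, h2⟩ := cip_stability hn hk hM1 hγ hM hc hU0 hF hB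
    have hN := l2Norm_nonneg (pl n U)
    have h3 : l2Norm (fun x => u x - pl n U x) ≤ l2Norm u + l2Norm (pl n U) := by
      have := l2Norm_add_le h.isL2On (MemLp.const_mul (pl_isL2On (U := U) hn) (-1))
      rw [l2Norm_const_mul] at this
      simpa [sub_eq_add_neg] using this
    have hdu2 : IsL2On 0 1 du := h.prim.1
    have h4 : l2Norm (fun x => du x - plDeriv n U x) ≤ l2Norm du + l2Norm (plDeriv n U) := by
      have := l2Norm_add_le hdu2 (MemLp.const_mul (plDeriv_isL2On (U := U) hn) (-1))
      rw [l2Norm_const_mul] at this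
      simpa [sub_eq_add_neg] using this
    have h5 : l2Norm du ≤ 3 / 2 * l2Norm f :=
      l2Norm_le_of_bound (by positivity) (fun x hx => h.norm_du_le hf hx) hdu2
    have h6 := h.l2Norm_le hk0.le hf
    have h7 := l2Norm_plDeriv_le hn (by positivity) h2
    set F := l2Norm f
    set p := k ^ 3 * (1 / (n : ℝ)) ^ 2
    have hp0 : 0 < p := by linarith
    -- Uses 1/p ≤ 7, so 84 = 12 · 7, and 1/|Im γ| ≤ M/|γ|. This is where the negative power of |γ|
    -- in the estimate originates.
    have h8 : 12 * F / (|γ.im| * p) ≤ 84 * (M * ‖γ‖⁻¹ * F) := by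
      rw [div_le_iff₀ (by positivity)]
      have e1 : 1 ≤ M * |γ.im| * ‖γ‖⁻¹ := by
        calc 1 = ‖γ‖ * ‖γ‖⁻¹ := hGinv.symm
          _ ≤ _ := by gcongr
      calc 12 * F ≤ 12 * F * (M * |γ.im| * ‖γ‖⁻¹) := le_mul_of_one_le_right (by positivity) e1
        _ = 84 * (F * (M * |γ.im| * ‖γ‖⁻¹)) * (1 / 7) := by ring
        _ ≤ 84 * (F * (M * |γ.im| * ‖γ‖⁻¹)) * p := by gcongr
        _ = _ := by ring
    have hmin : 1 / 7 ≤ min 1 p := le_min (by norm_num) hp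
    set A := ‖γ‖ + ‖γ‖⁻¹ with hAdef
    have e2 : M * ‖γ‖⁻¹ * F ≤ M * A * F := by
      gcongr
      rw [hAdef]; linarith
    have e3 : M * F ≤ M * A * F := by
      have : M * 1 * F ≤ M * A * F := by gcongr; linarith
      linarith
    have e4 : F ≤ M * F := le_mul_of_one_le_left hF hM1
    have e5 : 0 ≤ M * A * F := by positivity
    have e6 : 2000 * M * A * (1 / 7) * F ≤ 2000 * M * A * min 1 p * F := by gcongr
    constructor
    · calc _ ≤ k * (l2Norm u + l2Norm (pl n U)) := by gcongr
        _ ≤ 2000 * M * A * (1 / 7) * F := by linarith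
        _ ≤ _ := e6
    · have e7 : 2000 * M * A * min 1 p * F ≤
          2000 * M * A * (k * (1 / (n : ℝ)) + min 1 p) * F := by
        gcongr
        have : 0 ≤ k * (1 / (n : ℝ)) := by positivity
        linarith
      linarith

end FinalEstimate

end

theorem mainTheorem2 (M : ℝ) :
    ∃ c : ℝ, 0 < c ∧ ∀ C₀ : ℝ, ∃ C : ℝ, 0 < C ∧
      ∀ (γ : ℂ) (k : ℝ) (n : ℕ),
        γ.im < 0 → ‖γ‖ ≤ M * |γ.im| → 1 ≤ k → 1 ≤ n →
        k * (1 / (n : ℝ)) ≤ C₀ → ‖γ‖ * (k * (1 / (n : ℝ))) ≤ c →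
        ∀ f : ℝ → ℂ, MemLp f 2 (volume.restrict (Set.Ioo (0 : ℝ) 1)) →
          (∃ uh : ℝ → ℂ, IsCIPSolution k γ n f uh ∧
            ∀ wh : ℝ → ℂ, IsCIPSolution k γ n f wh → Set.EqOn wh uh (Set.Icc 0 1)) ∧
          ∀ u uh : ℝ → ℂ, IsHelmholtzSolution k f u → IsCIPSolution k γ n f uh →
            l2Norm (fun x => (k : ℂ) * (u x - uh x)) ≤
                C * (‖γ‖ + ‖γ‖⁻¹) * min 1 (k ^ 3 * (1 / (n : ℝ)) ^ 2) * l2Norm f ∧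
            l2Norm (deriv (fun x => u x - uh x)) ≤
                C * (‖γ‖ + ‖γ‖⁻¹) *
                  (k * (1 / (n : ℝ)) + min 1 (k ^ 3 * (1 / (n : ℝ)) ^ 2)) * l2Norm f := by
  -- The first witness is the threshold of `dissipation_le`. The maximum with 1 keeps the second one
  -- positive for every real `M`.
  refine ⟨1 / (2 * (1 + 2 * M ^ 2)), by positivity, fun _ => ⟨2000 * max 1 M, by positivity, ?_⟩⟩
  intro γ k n hγ hM hk hn _ hc f hf
  -- Forced by |Im γ| ≤ |γ| ≤ M|Im γ| with Im γ nonzero.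
  have hM1 : 1 ≤ M := by
    have h1 : |γ.im| ≤ M * |γ.im| := (Complex.abs_im_le_norm γ).trans hM
    exact le_of_mul_le_mul_right (by linarith) (abs_pos.2 hγ.ne)
  rw [max_eq_right hM1]
  refine ⟨exists_unique_cipSolution hn hk hM1 hγ hM hc hf, fun u uh hu huh => ?_⟩
  obtain ⟨du, d2u, h⟩ := hu.exists_data
  obtain ⟨c, hcv⟩ := exists_nodal_of_mem_FESpace hn huh.1
  have hall : ∀ V : ℕ → ℂ, V 0 = 0 → cipBilin k γ n (extendNodal n c) V =
      ∫ x in (0 : ℝ)..1, f x * pl n V x := fun V hV => by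
    have h1 := huh.2 (pl n (fun j => conj (V j))) (pl_mem_FESpace hn (by simp [hV]))
    rw [cipForm_eq hn hcv (fun _ _ => rfl), l2Inner_eq (fun _ _ => rfl)] at h1
    simpa using h1
  obtain ⟨h1, h2⟩ := nodal_error_bound hn hk hM1 hγ hM hc h hf (extendNodal_zero c) hall
  constructor
  · rw [l2Norm_const_mul, Complex.norm_real, Real.norm_of_nonneg (by linarith)]
    refine le_trans (le_of_eq ?_) h1
    congr 1
    refine l2Norm_congr (Filter.Eventually.of_forall fun x hx => ?_)
    rw [hcv x (Set.Ioc_subset_Icc_self hx)]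
  · refine le_trans (le_of_eq ?_) h2
    refine l2Norm_congr ?_
    filter_upwards [deriv_sub_eq_ae hn h hcv] with x hx hx1
    rw [hx hx1]
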